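/- Let $N,d\ge 1$, $\boldsymbol\theta_0\in\mathbb R^d$, $\sigma^2>0$, $\sigma_0^2>0$, $\eta\ge 0$ be fixed (in particular $\sigma^2$ does not depend on the data). Let $\mathbf Z$ be a random real $N\times d$ matrix with rows $\mathbf z_1,\dots,\mathbf z_N$, and let $\boldsymbol\epsilon\sim\mathcal N(\mathbf 0,\sigma_0^2\mathbf I_N)$ be independent of $\mathbf Z$. For a design matrix $\mathbf X\in\mathbb R^{N\times d}$ put $\mathbf J=\mathbf X^{\mathrm T}\mathbf X$ and $\mathbf J_{\sigma^2\eta}=\mathbf J+\sigma^2\eta\,\mathbf I_d$, and let $\hat{\boldsymbol\theta}(\mathbf X,\mathbf t)=\mathbf J_{\sigma^2\eta}^{-1}\mathbf X^{\mathrm T}\mathbf t$ whenever $\mathbf J_{\sigma^2\eta}$ is invertible. Write $\mathcal N(\mathbf m,\mathbf S)$ for the (possibly degenerate) normal law with mean $\mathbf m$ and covariance $\mathbf S$. (0) If $\mathbf J_{\sigma^2\eta}$ is invertible, then for every $\mathbf t\in\mathbb R^N$ the vector $\hat{\boldsymbol\theta}(\mathbf X,\mathbf t)$ is the MAP estimator,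 i.e. the unique minimiser over $\boldsymbol\theta\in\mathbb R^d$ of the energy $\frac1{2\sigma^2}\|\mathbf t-\mathbf X\boldsymbol\theta\|^2+\frac{\eta}{2}\|\boldsymbol\theta\|^2$. (1) Take $\mathbf X=\mathbf Z$ and $\mathbf t=\mathbf Z\boldsymbol\theta_0+\boldsymbol\epsilon$, and suppose that $\mathbf J_{\sigma^2\eta}$ is almost surely invertible (automatic if $\eta>0$). Then the law of $\hat{\boldsymbol\theta}=\hat{\boldsymbol\theta}(\mathbf Z,\mathbf t)$ is the average over $\mathbf Z$ of normal laws: for every Borel set $B\subseteq\mathbb R^d$, $$P(\hat{\boldsymbol\theta}\in B)=\Big\langle \mathcal N\big(\mathbf J_{\sigma^2\eta}^{-1}\mathbf J\boldsymbol\theta_0,\ \sigma_0^2\,\mathbf J_{\sigma^2\eta}^{-2}\mathbf J\big)(B)\Big\rangle_{\mathbf Z}.$$ (2) Suppose $d\le N$ and that $\mathbf z_1,\dots,\mathbf z_N$ are independent with law $\mathcal N(\mathbf 0,\boldsymbol\Sigma)$, $\boldsymbol\Sigma$ symmetric positive definite. Put $\zeta=d/N$ and take the rescaled design $\mathbf X=\mathbf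 Z/\sqrt d$ and $\mathbf t=\mathbf X\boldsymbol\theta_0+\boldsymbol\epsilon$. Then $\mathbf J_{\sigma^2\eta}$ is almost surely invertible; the sample covariance matrix $\mathbf C[\mathbf Z]=N^{-1}\mathbf Z^{\mathrm T}\mathbf Z$ has the Wishart law with density $$\mathcal W(\mathbf C\,|\,\boldsymbol\Sigma/N,d,N)=\frac{|\boldsymbol\Sigma/N|^{-N/2}\,|\mathbf C|^{(N-d-1)/2}\,\mathrm e^{-\frac N2\mathrm{Tr}(\mathbf C\boldsymbol\Sigma^{-1})}}{2^{Nd/2}\,\pi^{d(d-1)/4}\prod_{\ell=1}^d\Gamma\big(\frac{N+1-\ell}2\big)}$$ with respect to Lebesgue measure $\mathrm d\mathbf C=\prod_{k\le l}\mathrm dC_{kl}$ on the symmetric positive definite $d\times d$ matrices; and, with $\mathbf C_{\zeta\sigma^2\eta}=\mathbf C+\zeta\sigma^2\eta\,\mathbf I_d$, the law of $\hat{\boldsymbol\theta}=\hat{\boldsymbol\theta}(\mathbf X,\mathbf t)$ is the Gaussian mixture: for every Borel set $B\subseteq\mathbb R^d$, $$P(\hat{\boldsymbol\theta}\in B)=\int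 \mathrm d\mathbf C\ \mathcal W(\mathbf C\,|\,\boldsymbol\Sigma/N,d,N)\ \mathcal N\big(\mathbf C_{\zeta\sigma^2\eta}^{-1}\mathbf C\,\boldsymbol\theta_0,\ \zeta\sigma_0^2\,\mathbf C_{\zeta\sigma^2\eta}^{-2}\mathbf C\big)(B).$$ -/

import Mathlib

open MeasureTheory ProbabilityTheory
open scoped ENNReal Matrix

noncomputable section

namespace RidgeRegression

/-- Real matrices carry the product (equivalently, Borel) σ-algebra of their entries. -/
instance instMeasurableSpaceMatrix {m n : Type*} : MeasurableSpace (Matrix m n ℝ) :=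
  inferInstanceAs (MeasurableSpace (m → n → ℝ))

/-- The action `Z θ` of a matrix on a vector of Euclidean space. -/
def act {n d : ℕ} (Z : Matrix (Fin n) (Fin d) ℝ) (θ : EuclideanSpace ℝ (Fin d)) :
    EuclideanSpace ℝ (Fin n) :=
  WithLp.toLp 2 (Z *ᵥ θ.ofLp)

/-- The `θ`-dependent part of the ridge regression energy (negative log-posterior) for a
known noise parameter `σ²` (here `σ2`):
`E(θ) = ‖t - Z θ‖² / (2 σ²) + (η / 2) ‖θ‖²`. -/
def energy {N d : ℕ} (σ2 η : ℝ) (Z : Matrix (Fin N) (Fin d) ℝ) (t : EuclideanSpace ℝ (Fin N))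
    (θ : EuclideanSpace ℝ (Fin d)) : ℝ :=
  1 / (2 * σ2) * ‖t - act Z θ‖ ^ 2 + 1 / 2 * η * ‖θ‖ ^ 2

/-- The matrix `J = Zᵀ Z`. -/
def gram {N d : ℕ} (Z : Matrix (Fin N) (Fin d) ℝ) : Matrix (Fin d) (Fin d) ℝ := Zᵀ * Z

/-- The regularised matrix `A_c = A + c I`. -/
def reg {d : ℕ} (c : ℝ) (A : Matrix (Fin d) (Fin d) ℝ) : Matrix (Fin d) (Fin d) ℝ :=
  A + c • (1 : Matrix (Fin d) (Fin d) ℝ)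

/-- The MAP estimator `J_{σ²η}⁻¹ Zᵀ t`. -/
def mapEstimator {N d : ℕ} (σ2 η : ℝ) (Z : Matrix (Fin N) (Fin d) ℝ)
    (t : EuclideanSpace ℝ (Fin N)) : EuclideanSpace ℝ (Fin d) :=
  act ((reg (σ2 * η) (gram Z))⁻¹ * Zᵀ) t

/-- The sample covariance matrix `C = N⁻¹ Zᵀ Z`, i.e. `C k l = N⁻¹ ∑ i, z_i(k) z_i(l)`. -/
def sampleCov {N d : ℕ} (Z : Matrix (Fin N) (Fin d) ℝ) : Matrix (Fin d) (Fin d) ℝ :=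
  (N : ℝ)⁻¹ • (Zᵀ * Z)

/-- The normal law `N(A_c⁻¹ A θ₀, s A_c⁻² A)`, where `A_c = A + c I`. -/
def componentLaw {d : ℕ} (θ0 : EuclideanSpace ℝ (Fin d)) (c s : ℝ)
    (A : Matrix (Fin d) (Fin d) ℝ) : Measure (EuclideanSpace ℝ (Fin d)) :=
  multivariateGaussian (act ((reg c A)⁻¹ * A) θ0) (s • ((reg c A)⁻¹ ^ 2 * A))

/-- `ρ` is the average over `a ∼ ν` of the measures `κ a`. -/
def IsMixture {α β : Type*} [MeasurableSpace α] [MeasurableSpace β] (ρ : Measure β)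
    (ν : Measure α) (κ : α → Measure β) : Prop :=
  AEMeasurable κ ν ∧ ∀ B : Set β, MeasurableSet B → ρ B = ∫⁻ a, κ a B ∂ν

/-- The symmetric matrix with prescribed entries on and above the diagonal. -/
def symmOfUpper {d : ℕ} (v : {p : Fin d × Fin d // p.1 ≤ p.2} → ℝ) :
    Matrix (Fin d) (Fin d) ℝ :=
  Matrix.of fun i j => v ⟨(min i j, max i j), min_le_max⟩

/-- Lebesgue measure `dC = ∏_{k ≤ l} dC_{kl}` on the symmetric `d × d` matrices, as a measure on
all `d × d` matrices. -/
def symmLebesgue (d : ℕ) : Measure (Matrix (Fin d) (Fin d) ℝ) :=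
  (volume : Measure ({p : Fin d × Fin d // p.1 ≤ p.2} → ℝ)).map symmOfUpper

/-- The Wishart density with scale matrix `V` and `N` degrees of freedom,
`W(C | V, d, N) = |V|^{-N/2} |C|^{(N-d-1)/2} exp(-Tr(C V⁻¹)/2)
  / (2^{Nd/2} π^{d(d-1)/4} ∏_{l=1}^d Γ((N+1-l)/2))`. -/
def wishartDensity {d : ℕ} (V : Matrix (Fin d) (Fin d) ℝ) (N : ℕ)
    (C : Matrix (Fin d) (Fin d) ℝ) : ℝ :=
  V.det ^ (-(N : ℝ) / 2) * C.det ^ (((N : ℝ) - d - 1) / 2) *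
      Real.exp (-(1 / 2) * (C * V⁻¹).trace) /
    (2 ^ ((N : ℝ) * d / 2) * Real.pi ^ ((d : ℝ) * (d - 1) / 4) *
      ∏ l ∈ Finset.Icc 1 d, Real.Gamma (((N : ℝ) + 1 - l) / 2))

/-- The (non-singular) Wishart law: density `W(C | V, d, N)` with respect to `dC`, on the
symmetric positive definite matrices. -/
def wishart {d : ℕ} (V : Matrix (Fin d) (Fin d) ℝ) (N : ℕ) :
    Measure (Matrix (Fin d) (Fin d) ℝ) :=
  ((symmLebesgue d).restrict {C | C.PosDef}).withDensity
    fun C => ENNReal.ofReal (wishartDensity V N C)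

end RidgeRegression

end

/-! Given the design, the estimator is an affine image of Gaussian noise, hence normal; its
covariance simplifies because `(reg c A)⁻¹` commutes with `A` (`map_mapEstimator_eq_componentLaw`).
Independence and Fubini then average over the design (`isMixture_mapEstimator`). The MAP property is
the exact second-order expansion of the energy around the solution of the normal equations
(`energy_eq_add`).

For Gaussian rows the conditional law depends on the design only through its Gram matrix, which is
the sample covariance divided by `ζ`. It remains to find the law of the sample covariance
(`hasLaw_sampleCov_wishart`), and this is done by Laplace transforms. A linear functional of the
sample covariance is a sum of independent quadratic forms in the rows, so its transform is a product
of Gaussian integrals. On the Wishart side the exponential is absorbed into the density, which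
leaves a multivariate gamma integral. With `V = S / N`, both sides equal `det(1 - 2VT) ^ (-N/2)` for
small symmetric `T`, and analytic continuation to the imaginary axis identifies the measures
(`ext_of_eventually_lintegral_exp_eq`). Almost sure invertibility follows because the Wishart law is
carried by positive definite matrices.

The gamma integral `lintegral_posDef_det_rpow_mul_exp` goes by induction on the dimension. Splitting
off the first row and column and passing to the Schur complement of the corner turns the positive
definite cone into a product: the block gives the integral in one dimension less, the border a
Gaussian integral, the corner a Gamma integral. -/

noncomputable section

namespace RidgeRegression

/-! ### Gaussian integrals -/

/-- The standard Gaussian law on `ι → ℝ` has the product density. -/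
lemma pi_gaussianReal_eq_withDensity {ι : Type*} [Fintype ι] :
    Measure.pi (fun _ : ι => gaussianReal 0 1) =
      (volume : Measure (ι → ℝ)).withDensity
        fun x => ENNReal.ofReal (∏ i, gaussianPDFReal 0 1 (x i)) := by
  refine Measure.pi_eq fun s hs => ?_
  rw [withDensity_apply _ (MeasurableSet.univ_pi hs), volume_pi, Measure.restrict_pi_pi,
    ← ofReal_integral_eq_lintegral_ofReal
      (Integrable.fintype_prod fun i => (integrable_gaussianPDFReal 0 1).integrableOn)
      (Filter.Eventually.of_forall fun x =>
        Finset.prod_nonneg fun i _ => gaussianPDFReal_nonneg _ _ _),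
    integral_fintype_prod_eq_prod (fun _ : ι => gaussianPDFReal 0 1),
    ENNReal.ofReal_prod_of_nonneg
      fun i _ => integral_nonneg fun x => gaussianPDFReal_nonneg _ _ _]
  exact Finset.prod_congr rfl fun i _ => (gaussianReal_apply_eq_integral 0 one_ne_zero _).symm

lemma lintegral_exp_neg_sum_sq (ι : Type*) [Fintype ι] :
    ∫⁻ x : ι → ℝ, ENNReal.ofReal (Real.exp (-∑ i, x i ^ 2)) =
      ENNReal.ofReal (Real.pi ^ ((Fintype.card ι : ℝ) / 2)) := by
  have hint : Integrable fun x : ℝ => Real.exp (-1 * x ^ 2) := integrable_exp_neg_mul_sq one_pos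
  have hprod : ∀ x : ι → ℝ, Real.exp (-∑ i, x i ^ 2) = ∏ i, Real.exp (-1 * x i ^ 2) := fun x => by
    rw [← Real.exp_sum]; simp
  simp_rw [hprod]
  rw [volume_pi, ← ofReal_integral_eq_lintegral_ofReal (Integrable.fintype_prod fun _ => hint)
      (Filter.Eventually.of_forall fun x => Finset.prod_nonneg fun i _ => (Real.exp_pos _).le),
    integral_fintype_prod_eq_prod (fun (_ : ι) (y : ℝ) => Real.exp (-1 * y ^ 2))]
  simp_rw [integral_gaussian, div_one]
  rw [Finset.prod_const, Finset.card_univ, Real.sqrt_eq_rpow, ← Real.rpow_mul_natCast Real.pi_pos.le]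
  congr 2; ring

open scoped MatrixOrder in
/-- A positive definite matrix is the Gram matrix of an invertible one. -/
lemma exists_transpose_mul_self_eq {ι : Type*} [Fintype ι] [DecidableEq ι] {M : Matrix ι ι ℝ}
    (hM : M.PosDef) : ∃ R : Matrix ι ι ℝ, Rᵀ * R = M ∧ R.det = √M.det ∧ 0 < R.det := by
  have h1 : (CFC.sqrt M).det = √M.det := by
    simpa [RCLike.sqrt_of_nonneg hM.posSemidef.det_nonneg] using hM.posSemidef.det_sqrt
  refine ⟨CFC.sqrt M, ?_, h1, h1 ▸ Real.sqrt_pos.2 hM.det_pos⟩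
  have h2 := (Matrix.nonneg_iff_posSemidef.1 (CFC.sqrt_nonneg M)).isHermitian
  rw [← Matrix.conjTranspose_eq_transpose_of_trivial, h2.eq,
    CFC.sqrt_mul_sqrt_self M hM.posSemidef.nonneg]

lemma lintegral_comp_mulVec {ι : Type*} [Fintype ι] [DecidableEq ι] {R : Matrix ι ι ℝ}
    (hR : 0 < R.det) {f : (ι → ℝ) → ℝ≥0∞} (hf : Measurable f) :
    ∫⁻ x, f (R *ᵥ x) = ENNReal.ofReal R.det⁻¹ * ∫⁻ x, f x := by
  have h := Real.map_matrix_volume_pi_eq_smul_volume_pi hR.ne'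
  rw [abs_of_pos (inv_pos.2 hR)] at h
  rw [← smul_eq_mul, ← lintegral_smul_measure, ← h, lintegral_map hf (by fun_prop)]
  simp

/-- The Gaussian integral of a positive definite quadratic form. -/
lemma lintegral_exp_neg_quadratic {ι : Type*} [Fintype ι] [DecidableEq ι] {M : Matrix ι ι ℝ}
    (hM : M.PosDef) :
    ∫⁻ x : ι → ℝ, ENNReal.ofReal (Real.exp (-(x ⬝ᵥ M *ᵥ x))) =
      ENNReal.ofReal (Real.pi ^ ((Fintype.card ι : ℝ) / 2) * M.det ^ (-(1 / 2) : ℝ)) := by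
  obtain ⟨R, rfl, hdet, hpos⟩ := exists_transpose_mul_self_eq hM
  have h : ∀ x : ι → ℝ, x ⬝ᵥ (Rᵀ * R) *ᵥ x = ∑ i, (R *ᵥ x) i ^ 2 := fun x => by
    rw [← Matrix.mulVec_mulVec, Matrix.dotProduct_mulVec, Matrix.vecMul_transpose, dotProduct]
    simp [sq]
  simp_rw [h]
  rw [lintegral_comp_mulVec hpos (f := fun y => ENNReal.ofReal (Real.exp (-∑ i, y i ^ 2)))
    (by fun_prop), lintegral_exp_neg_sum_sq, ← ENNReal.ofReal_mul (inv_pos.2 hpos).le, hdet,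
    Real.rpow_neg hM.det_pos.le, ← Real.sqrt_eq_rpow, mul_comm]

/-- A Gaussian integral with a linear term, by completing the square. -/
lemma lintegral_exp_neg_quadratic_add_linear {ι : Type*} [Fintype ι] [DecidableEq ι]
    {M : Matrix ι ι ℝ} (hM : M.PosDef) (m : ι → ℝ) {a : ℝ} (ha : 0 < a) :
    ∫⁻ x : ι → ℝ, ENNReal.ofReal (Real.exp (-(a⁻¹ * (x ⬝ᵥ M *ᵥ x) + 2 * (m ⬝ᵥ x)))) =
      ENNReal.ofReal (Real.exp (a * (m ⬝ᵥ M⁻¹ *ᵥ m)) *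
        (Real.pi ^ ((Fintype.card ι : ℝ) / 2) * a ^ ((Fintype.card ι : ℝ) / 2) *
          M.det ^ (-(1 / 2) : ℝ))) := by
  have hMt : Mᵀ = M := by simpa using hM.isHermitian.eq
  have hu : IsUnit M.det := hM.det_pos.ne'.isUnit
  -- The minimiser of the exponent's quadratic is `-a • M⁻¹ *ᵥ m`; translating it to the origin
  -- removes the linear term.
  have hsq : ∀ x : ι → ℝ, -(a⁻¹ * ((x - a • M⁻¹ *ᵥ m) ⬝ᵥ M *ᵥ (x - a • M⁻¹ *ᵥ m)) +
      2 * (m ⬝ᵥ (x - a • M⁻¹ *ᵥ m))) = a * (m ⬝ᵥ M⁻¹ *ᵥ m) + -(x ⬝ᵥ (a⁻¹ • M) *ᵥ x) := fun x => by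
    have e1 : M *ᵥ (M⁻¹ *ᵥ m) = m := by
      rw [Matrix.mulVec_mulVec, Matrix.mul_nonsing_inv _ hu, Matrix.one_mulVec]
    have e2 : (M⁻¹ *ᵥ m) ⬝ᵥ M *ᵥ x = m ⬝ᵥ x := by
      rw [Matrix.dotProduct_mulVec, ← Matrix.mulVec_transpose, hMt, e1]
    simp only [Matrix.mulVec_sub, Matrix.mulVec_smul, sub_dotProduct, dotProduct_sub,
      smul_dotProduct, dotProduct_smul, smul_eq_mul, e1, e2, Matrix.smul_mulVec]
    rw [dotProduct_comm x m, dotProduct_comm (M⁻¹ *ᵥ m) m]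
    field_simp
    ring
  rw [← lintegral_sub_right_eq_self _ (a • M⁻¹ *ᵥ m)]
  simp_rw [hsq, Real.exp_add, ENNReal.ofReal_mul (Real.exp_pos _).le]
  rw [lintegral_const_mul _ (by fun_prop),
    lintegral_exp_neg_quadratic (hM.smul (inv_pos.2 ha)), Matrix.det_smul,
    Real.mul_rpow (by positivity) hM.det_pos.le]
  congr 2
  rw [← Real.rpow_natCast, ← Real.rpow_mul (by positivity), Real.inv_rpow ha.le, ← Real.rpow_neg ha.le]
  ring_nf

lemma lintegral_Ioi_rpow_mul_exp_neg {a r : ℝ} (ha : 0 < a) (hr : 0 < r) :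
    ∫⁻ t in Set.Ioi 0, ENNReal.ofReal (t ^ (a - 1) * Real.exp (-(r * t))) =
      ENNReal.ofReal (r ^ (-a) * Real.Gamma a) := by
  have h := Real.integral_rpow_mul_exp_neg_mul_Ioi ha hr
  have hpos : 0 < (1 / r) ^ a * Real.Gamma a :=
    mul_pos (Real.rpow_pos_of_pos (by positivity) _) (Real.Gamma_pos_of_pos ha)
  rw [← ofReal_integral_eq_lintegral_ofReal
    -- A non-integrable function has Bochner integral zero, whereas the known value is positive.
    (by by_contra hc; rw [integral_undef hc] at h; exact hpos.ne h)
    ((ae_restrict_iff' measurableSet_Ioi).2 (Filter.Eventually.of_forall fun t ht =>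
      mul_nonneg (Real.rpow_nonneg (le_of_lt ht) _) (Real.exp_pos _).le)), h, one_div,
    Real.inv_rpow hr.le, Real.rpow_neg hr.le]

/-! ### Bordered matrices -/

/-- The symmetric bordered matrix with corner `a`, border `b` and remaining block `D`. -/
def bordered {d : ℕ} (a : ℝ) (b : Fin d → ℝ) (D : Matrix (Fin d) (Fin d) ℝ) :
    Matrix (Fin (d + 1)) (Fin (d + 1)) ℝ :=
  Matrix.of (Fin.cons (Fin.cons a b) fun i => Fin.cons (b i) (D i))

/-- The unit lower triangular matrix with first column `(1, u)`, trivial elsewhere. -/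
def shear {d : ℕ} (u : Fin d → ℝ) : Matrix (Fin (d + 1)) (Fin (d + 1)) ℝ :=
  Matrix.of (Fin.cons (Fin.cons 1 0) fun i => Fin.cons (u i) ((1 : Matrix (Fin d) (Fin d) ℝ) i))

section bordered

variable {d : ℕ} (a : ℝ) (b u : Fin d → ℝ) (D : Matrix (Fin d) (Fin d) ℝ) (i j : Fin d)

@[simp] lemma bordered_zero_zero : bordered a b D 0 0 = a := rfl
@[simp] lemma bordered_zero_succ : bordered a b D 0 j.succ = b j := rfl
@[simp] lemma bordered_succ_zero : bordered a b D i.succ 0 = b i := rfl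
@[simp] lemma bordered_succ_succ : bordered a b D i.succ j.succ = D i j := rfl
@[simp] lemma shear_zero_zero : shear u 0 0 = 1 := rfl
@[simp] lemma shear_zero_succ : shear u 0 j.succ = 0 := rfl
@[simp] lemma shear_succ_zero : shear u i.succ 0 = u i := rfl
@[simp] lemma shear_succ_succ : shear u i.succ j.succ = (1 : Matrix (Fin d) (Fin d) ℝ) i j := rfl

lemma eq_bordered {M : Matrix (Fin (d + 1)) (Fin (d + 1)) ℝ} (hM : Mᵀ = M) :
    M = bordered (M 0 0) (fun i => M i.succ 0) (M.submatrix Fin.succ Fin.succ) := by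
  ext i j
  refine Fin.cases ?_ (fun i => ?_) i <;> refine Fin.cases ?_ (fun j => ?_) j <;> try rfl
  exact (congrFun₂ hM 0 j.succ).symm

lemma det_shear : (shear u).det = 1 := by
  have : (shear u).submatrix (Fin.succAbove 0) Fin.succ = 1 := by ext i j; simp
  rw [Matrix.det_succ_row_zero, Fin.sum_univ_succ]
  simp [Matrix.submatrix, Fin.zero_succAbove] at this ⊢
  rw [this, Matrix.det_one]

lemma det_bordered_zero : (bordered a 0 D).det = a * D.det := by
  rw [Matrix.det_succ_row_zero, Fin.sum_univ_succ]
  simp only [bordered_zero_zero, bordered_zero_succ, Pi.zero_apply]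
  simp
  left; rfl

/-- Elimination of the border against the corner. -/
lemma shear_mul_bordered_mul (ha : a ≠ 0) :
    shear (a⁻¹ • b) * bordered a 0 D * (shear (a⁻¹ • b))ᵀ =
      bordered a b (D + a⁻¹ • Matrix.vecMulVec b b) := by
  ext i j
  refine Fin.cases ?_ (fun i => ?_) i <;> refine Fin.cases ?_ (fun j => ?_) j <;>
    simp [Matrix.mul_apply, Fin.sum_univ_succ, Matrix.one_apply, Matrix.vecMulVec_apply]
  all_goals field_simp
  ring

/-- Elimination of the border against the block. -/
lemma shear_transpose_mul_bordered_mul (hD : Dᵀ = D) :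
    (shear u)ᵀ * bordered a 0 D * shear u = bordered (a + u ⬝ᵥ D *ᵥ u) (D *ᵥ u) D := by
  ext i j
  refine Fin.cases ?_ (fun i => ?_) i <;> refine Fin.cases ?_ (fun j => ?_) j <;>
    simp [Matrix.mul_apply, Fin.sum_univ_succ, Matrix.one_apply, dotProduct, Matrix.mulVec,
      Finset.mul_sum, Finset.sum_mul]
  · rw [Finset.sum_comm]; exact Finset.sum_congr rfl fun _ _ => Finset.sum_congr rfl fun _ _ => by ring
  · refine Finset.sum_congr rfl fun k _ => ?_
    rw [mul_comm, ← congrFun₂ hD j k, Matrix.transpose_apply]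

lemma posDef_bordered_zero_iff : (bordered a 0 D).PosDef ↔ 0 < a ∧ D.PosDef := by
  constructor
  · intro h
    exact ⟨h.diag_pos (i := 0), h.submatrix (Fin.succ_injective _)⟩
  · rintro ⟨ha, hD⟩
    refine Matrix.PosDef.of_dotProduct_mulVec_pos ?_ fun x hx => ?_
    · ext i j
      refine Fin.cases ?_ (fun i => ?_) i <;> refine Fin.cases ?_ (fun j => ?_) j <;> simp
      simpa using congrFun₂ hD.isHermitian.eq i j
    · have : star x ⬝ᵥ bordered a 0 D *ᵥ x = a * x 0 ^ 2 + Fin.tail x ⬝ᵥ D *ᵥ Fin.tail x := by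
        simp [dotProduct, Matrix.mulVec, Fin.sum_univ_succ, Fin.tail]; ring
      rw [this]
      rcases eq_or_ne (Fin.tail x) 0 with h0 | h0
      · have hx0 : x 0 ≠ 0 := fun h => hx <| by
          ext i; exact Fin.cases h (fun i => congrFun h0 i) i
        rw [h0]; simp; positivity
      · have := hD.dotProduct_mulVec_pos h0
        simp only [star_trivial] at this
        positivity

lemma det_bordered_add (ha : a ≠ 0) :
    (bordered a b (D + a⁻¹ • Matrix.vecMulVec b b)).det = a * D.det := by
  rw [← shear_mul_bordered_mul a b D ha, Matrix.det_mul, Matrix.det_mul, Matrix.det_transpose,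
    det_shear, det_bordered_zero]
  ring

lemma isUnit_shear : IsUnit (shear u) := by
  rw [Matrix.isUnit_iff_isUnit_det, det_shear]; exact isUnit_one

/-- Congruence by an invertible shear preserves definiteness. After the shift of the block by `a⁻¹ b
bᵀ`, the domain no longer involves the border, which is what lets Fubini separate the variables. -/
lemma posDef_bordered_add_iff (ha : a ≠ 0) :
    (bordered a b (D + a⁻¹ • Matrix.vecMulVec b b)).PosDef ↔ 0 < a ∧ D.PosDef := by
  rw [← shear_mul_bordered_mul a b D ha, ← posDef_bordered_zero_iff]
  exact Matrix.IsUnit.posDef_star_right_conjugate_iff (isUnit_shear (a⁻¹ • b))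

lemma trace_bordered_mul (a' : ℝ) (b' : Fin d → ℝ) (D' : Matrix (Fin d) (Fin d) ℝ) :
    (bordered a b D * bordered a' b' D').trace = a * a' + 2 * (b' ⬝ᵥ b) + (D * D').trace := by
  simp [Matrix.trace, Matrix.mul_apply, Fin.sum_univ_succ, dotProduct, Finset.sum_add_distrib]
  rw [Finset.mul_sum, add_assoc, ← add_assoc (∑ i, b i * b' i), ← Finset.sum_add_distrib,
    Finset.sum_congr rfl fun i _ => show b i * b' i + b i * b' i = 2 * (b' i * b i) by ring]
  ring

/-- Schur decomposition of a positive definite matrix with respect to its first index. -/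
lemma exists_schur {M : Matrix (Fin (d + 1)) (Fin (d + 1)) ℝ} (hM : M.PosDef) :
    ∃ (s : ℝ) (m : Fin d → ℝ) (M' : Matrix (Fin d) (Fin d) ℝ), 0 < s ∧ M'.PosDef ∧
      M = bordered (s + m ⬝ᵥ M'⁻¹ *ᵥ m) m M' ∧ M.det = s * M'.det := by
  have hM' : (M.submatrix Fin.succ Fin.succ).PosDef := hM.submatrix (Fin.succ_injective _)
  have hMt : Mᵀ = M := by simpa using hM.isHermitian.eq
  set m : Fin d → ℝ := fun i => M i.succ 0
  set M' := M.submatrix Fin.succ Fin.succ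
  have hD : M'ᵀ = M' := by simpa using hM'.isHermitian.eq
  -- The solution of `M' u = m`: the shear along `u` recreates the border `m` from a block-diagonal
  -- matrix, whose corner is then the Schur complement.
  set u := M'⁻¹ *ᵥ m
  have hu : M' *ᵥ u = m := by
    rw [Matrix.mulVec_mulVec, Matrix.mul_nonsing_inv _ hM'.det_pos.ne'.isUnit, Matrix.one_mulVec]
  have h := shear_transpose_mul_bordered_mul (M 0 0 - m ⬝ᵥ u) u M' hD
  rw [hu, dotProduct_comm u m, sub_add_cancel, ← eq_bordered hMt] at h
  have hpd : (bordered (M 0 0 - m ⬝ᵥ u) 0 M').PosDef :=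
    (Matrix.IsUnit.posDef_star_left_conjugate_iff (isUnit_shear u)).1 (h.symm ▸ hM)
  refine ⟨M 0 0 - m ⬝ᵥ u, m, M', ((posDef_bordered_zero_iff _ _).1 hpd).1, hM', ?_, ?_⟩
  · rw [sub_add_cancel]; exact eq_bordered hMt
  · conv_lhs => rw [← h, Matrix.det_mul, Matrix.det_mul, Matrix.det_transpose, det_shear,
      det_bordered_zero, one_mul, mul_one]

end bordered

/-- Serves the base case of the induction and the case `d = 0`, in which scaling by `d` or `N` may
degenerate. -/
lemma posDef_of_fin_zero (A : Matrix (Fin 0) (Fin 0) ℝ) : A.PosDef :=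
  Matrix.PosDef.of_dotProduct_mulVec_pos (Subsingleton.elim _ _)
    fun x hx => absurd (Subsingleton.elim x 0) hx

/-! ### Measurability of matrix operations -/

instance instBorelSpaceMatrix {m n : Type*} [Countable m] [Countable n] :
    BorelSpace (Matrix m n ℝ) :=
  inferInstanceAs (BorelSpace (m → n → ℝ))

instance instSecondCountableTopologyMatrix {m n : Type*} [Countable m] [Countable n] :
    SecondCountableTopology (Matrix m n ℝ) :=
  inferInstanceAs (SecondCountableTopology (m → n → ℝ))

lemma isClosed_setOf_posSemidef (n : Type*) [Fintype n] :
    IsClosed {C : Matrix n n ℝ | C.PosSemidef} := by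
  simp_rw [Matrix.posSemidef_iff_dotProduct_mulVec, Set.ofPred_and, Set.ofPred_forall]
  refine IsClosed.inter (isClosed_eq (by fun_prop) continuous_id) (isClosed_iInter fun x => ?_)
  exact isClosed_le continuous_const (by fun_prop)

/-- Inside the closed semidefinite cone, definiteness is the nonvanishing of the determinant. -/
lemma measurableSet_setOf_posDef (n : Type*) [Fintype n] :
    MeasurableSet {C : Matrix n n ℝ | C.PosDef} := by
  classical
  have : {C : Matrix n n ℝ | C.PosDef} = {C | C.PosSemidef} ∩ {C | C.det = 0}ᶜ := by
    ext C
    exact ⟨fun h => ⟨h.posSemidef, h.det_pos.ne'⟩, fun h => h.1.posDef_iff_det_ne_zero.2 h.2⟩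
  rw [this]
  exact (isClosed_setOf_posSemidef n).measurableSet.inter
    (isClosed_eq (by fun_prop) continuous_const).measurableSet.compl

/-- The formula `det⁻¹ • adjugate` also covers singular matrices, where both sides are zero, so no
restriction to invertible ones is needed. -/
lemma measurable_matrix_inv (n : Type*) [Fintype n] [DecidableEq n] :
    Measurable fun C : Matrix n n ℝ => C⁻¹ := by
  simp_rw [Matrix.inv_def, Ring.inverse_eq_inv']
  have h1 : Measurable fun C : Matrix n n ℝ => C.det⁻¹ :=
    (Continuous.measurable (by fun_prop)).inv
  have h2 : Measurable fun C : Matrix n n ℝ => C.adjugate := Continuous.measurable (by fun_prop)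
  refine measurable_pi_lambda _ fun i => measurable_pi_lambda _ fun j => ?_
  exact h1.mul ((measurable_pi_apply j).comp ((measurable_pi_apply i).comp h2))

/-! ### The multivariate gamma integral -/

/-- Splitting the upper triangular index set into corner, border and remaining block. -/
def upperSplit (d : ℕ) : Unit ⊕ (Fin d ⊕ {p : Fin d × Fin d // p.1 ≤ p.2}) ≃
    {p : Fin (d + 1) × Fin (d + 1) // p.1 ≤ p.2} :=
  Equiv.ofBijective
    (Sum.elim (fun _ => ⟨(0, 0), le_rfl⟩) (Sum.elim (fun j => ⟨(0, j.succ), Fin.zero_le _⟩)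
      fun p => ⟨(p.1.1.succ, p.1.2.succ), Fin.succ_le_succ_iff.2 p.2⟩)) <| by
    constructor
    · rintro (x | x | ⟨⟨x, x'⟩, hx⟩) (y | y | ⟨⟨y, y'⟩, hy⟩) h <;>
        simp_all [Fin.succ_ne_zero, (Fin.succ_ne_zero _).symm]
    · rintro ⟨⟨i, j⟩, h⟩
      induction i using Fin.cases with
      | zero =>
        induction j using Fin.cases with
        | zero => exact ⟨Sum.inl (), rfl⟩
        | succ j => exact ⟨Sum.inr (Sum.inl j), rfl⟩
      | succ i =>
        induction j using Fin.cases with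
        | zero => exact absurd h (by simp)
        | succ j => exact ⟨Sum.inr (Sum.inr ⟨(i, j), Fin.succ_le_succ_iff.1 h⟩), rfl⟩

/-- Assembling upper triangular entries from corner, border and remaining block. -/
def upperGlue (d : ℕ) (x : ℝ × (Fin d → ℝ) × ({p : Fin d × Fin d // p.1 ≤ p.2} → ℝ)) :
    {p : Fin (d + 1) × Fin (d + 1) // p.1 ≤ p.2} → ℝ :=
  fun p => Sum.elim (fun _ => x.1) (Sum.elim x.2.1 x.2.2) ((upperSplit d).symm p)

lemma measurePreserving_upperGlue (d : ℕ) : MeasurePreserving (upperGlue d) := by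
  have h1 := (volume_preserving_funUnique Unit ℝ).symm
  have h2 := measurePreserving_sumPiEquivProdPi_symm
    (fun _ : Fin d ⊕ {p : Fin d × Fin d // p.1 ≤ p.2} => (volume : Measure ℝ))
  have h3 := measurePreserving_sumPiEquivProdPi_symm
    (fun _ : Unit ⊕ (Fin d ⊕ {p : Fin d × Fin d // p.1 ≤ p.2}) => (volume : Measure ℝ))
  have h4 := volume_measurePreserving_piCongrLeft (fun _ => ℝ) (upperSplit d)
  refine (?_ : upperGlue d = _) ▸ h4.comp (h3.comp (h1.prod h2))
  refine funext fun x => funext fun p => ?_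
  obtain ⟨q, rfl⟩ := (upperSplit d).surjective p
  simp only [upperGlue, Equiv.symm_apply_apply, Function.comp_apply,
    MeasurableEquiv.coe_piCongrLeft, Equiv.piCongrLeft_apply_apply]
  rcases q with q | q | q <;> rfl

lemma symmOfUpper_upperGlue {d : ℕ}
    (x : ℝ × (Fin d → ℝ) × ({p : Fin d × Fin d // p.1 ≤ p.2} → ℝ)) :
    symmOfUpper (upperGlue d x) = bordered x.1 x.2.1 (symmOfUpper x.2.2) := by
  have h0 : (upperSplit d).symm ⟨(0, 0), le_rfl⟩ = Sum.inl () := by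
    rw [Equiv.symm_apply_eq]; rfl
  have h1 : ∀ j : Fin d, (upperSplit d).symm ⟨(0, j.succ), Fin.zero_le _⟩ = Sum.inr (Sum.inl j) :=
    fun j => by rw [Equiv.symm_apply_eq]; rfl
  have h2 : ∀ (i j : Fin d) (h : i ≤ j), (upperSplit d).symm
      ⟨(i.succ, j.succ), Fin.succ_le_succ_iff.2 h⟩ = Sum.inr (Sum.inr ⟨(i, j), h⟩) :=
    fun i j h => by rw [Equiv.symm_apply_eq]; rfl
  ext i j
  refine Fin.cases ?_ (fun i => ?_) i <;> refine Fin.cases ?_ (fun j => ?_) j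
  · simp [symmOfUpper, upperGlue, h0]
  · simp [symmOfUpper, upperGlue, h1]
  · simp [symmOfUpper, upperGlue, h1]
  · have e1 : min i.succ j.succ = (min i j).succ := ((Fin.strictMono_succ).monotone.map_min).symm
    have e2 : max i.succ j.succ = (max i j).succ := ((Fin.strictMono_succ).monotone.map_max).symm
    simp only [symmOfUpper, upperGlue, Matrix.of_apply, bordered_succ_succ, e1, e2]
    rw [h2 _ _ min_le_max]; rfl

lemma measurable_symmOfUpper (d : ℕ) : Measurable (symmOfUpper (d := d)) :=
  measurable_pi_lambda _ fun _ => measurable_pi_lambda _ fun _ => measurable_pi_apply _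

instance instSFiniteSymmLebesgue (d : ℕ) : SFinite (symmLebesgue d) := by
  unfold symmLebesgue; infer_instance

lemma measurable_bordered (d : ℕ) :
    Measurable fun x : ℝ × (Fin d → ℝ) × Matrix (Fin d) (Fin d) ℝ => bordered x.1 x.2.1 x.2.2 := by
  refine measurable_pi_lambda _ fun i => measurable_pi_lambda _ fun j => ?_
  refine Fin.cases ?_ (fun i => ?_) i <;> refine Fin.cases ?_ (fun j => ?_) j
  · exact measurable_fst
  · exact (measurable_pi_apply j).comp measurable_snd.fst
  · exact (measurable_pi_apply i).comp measurable_snd.fst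
  · exact (measurable_pi_apply j).comp ((measurable_pi_apply i).comp measurable_snd.snd)

/-- Fubini for Lebesgue measure on symmetric matrices. -/
lemma lintegral_symmLebesgue_succ {d : ℕ} {f : Matrix (Fin (d + 1)) (Fin (d + 1)) ℝ → ℝ≥0∞}
    (hf : Measurable f) :
    ∫⁻ C, f C ∂symmLebesgue (d + 1) =
      ∫⁻ a : ℝ, ∫⁻ b : Fin d → ℝ, ∫⁻ D, f (bordered a b D) ∂symmLebesgue d := by
  have hS := measurable_symmOfUpper d
  rw [symmLebesgue, lintegral_map hf (measurable_symmOfUpper _),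
    ← (measurePreserving_upperGlue d).lintegral_comp
      (f := fun v => f (symmOfUpper v)) (hf.comp (measurable_symmOfUpper _))]
  simp_rw [symmOfUpper_upperGlue]
  have hg : Measurable fun x : ℝ × (Fin d → ℝ) × ({p : Fin d × Fin d // p.1 ≤ p.2} → ℝ) =>
      f (bordered x.1 x.2.1 (symmOfUpper x.2.2)) :=
    hf.comp ((measurable_bordered d).comp (measurable_fst.prodMk
      (measurable_snd.fst.prodMk (hS.comp measurable_snd.snd))))
  have e := lintegral_prod (μ := (volume : Measure ℝ))
    (ν := (volume : Measure ((Fin d → ℝ) × ({p : Fin d × Fin d // p.1 ≤ p.2} → ℝ)))) _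
    hg.aemeasurable
  refine e.trans (lintegral_congr fun a => ?_)
  have e := lintegral_prod (μ := (volume : Measure (Fin d → ℝ)))
    (ν := (volume : Measure ({p : Fin d × Fin d // p.1 ≤ p.2} → ℝ)))
    (fun x => f (bordered a x.1 (symmOfUpper x.2))) (hg.comp measurable_prodMk_left).aemeasurable
  refine e.trans (lintegral_congr fun b => ?_)
  rw [symmLebesgue, lintegral_map _ hS]
  exact hf.comp ((measurable_bordered d).comp
    (measurable_const.prodMk (measurable_const.prodMk measurable_id)))

lemma symmOfUpper_restrict {d : ℕ} {A : Matrix (Fin d) (Fin d) ℝ} (hA : Aᵀ = A) :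
    symmOfUpper (fun p => A p.1.1 p.1.2) = A := by
  ext i j
  rcases le_total i j with h | h
  · simp [symmOfUpper, h]
  · simpa [symmOfUpper, h] using congrFun₂ hA i j

/-- Symmetry of the shift keeps it inside the space of symmetric matrices, where it is a translation
of the upper triangular coordinates. It is applied to the rank-one Schur correction. -/
lemma lintegral_symmLebesgue_add_right {d : ℕ} {f : Matrix (Fin d) (Fin d) ℝ → ℝ≥0∞}
    (hf : Measurable f) {A : Matrix (Fin d) (Fin d) ℝ} (hA : Aᵀ = A) :
    ∫⁻ C, f (C + A) ∂symmLebesgue d = ∫⁻ C, f C ∂symmLebesgue d := by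
  have hS := measurable_symmOfUpper d
  have hadd : Measurable fun C : Matrix (Fin d) (Fin d) ℝ => C + A :=
    Continuous.measurable (by fun_prop)
  rw [symmLebesgue, lintegral_map hf hS, lintegral_map (f := fun C => f (C + A)) (hf.comp hadd) hS,
    ← lintegral_add_right_eq_self (fun v => f (symmOfUpper v)) fun p => A p.1.1 p.1.2]
  refine lintegral_congr fun v => ?_
  congr 1
  conv_lhs => rw [← symmOfUpper_restrict hA]
  rfl

lemma symmLebesgue_zero : symmLebesgue 0 = Measure.dirac 0 := by
  have : (volume : Measure ({p : Fin 0 × Fin 0 // p.1 ≤ p.2} → ℝ)) = Measure.dirac 0 := by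
    rw [volume_pi]; exact Measure.pi_of_empty _ _
  rw [symmLebesgue, this, Measure.map_dirac' (measurable_symmOfUpper 0)]
  congr 1

lemma measurable_gammaIntegrand {d : ℕ} (α : ℝ) (M : Matrix (Fin d) (Fin d) ℝ) :
    Measurable ({C : Matrix (Fin d) (Fin d) ℝ | C.PosDef}.indicator fun C =>
      ENNReal.ofReal (C.det ^ α * Real.exp (-(C * M).trace))) := by
  have h1 : Measurable fun C : Matrix (Fin d) (Fin d) ℝ => C.det :=
    Continuous.measurable (by fun_prop)
  have h2 : Measurable fun C : Matrix (Fin d) (Fin d) ℝ => (C * M).trace :=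
    Continuous.measurable (by fun_prop)
  exact Measurable.indicator (by fun_prop) (measurableSet_setOf_posDef _)

/-- The multivariate gamma integral over positive definite matrices. -/
theorem lintegral_posDef_det_rpow_mul_exp {d : ℕ} {β : ℝ} (hβ : ((d : ℝ) - 1) / 2 < β)
    {M : Matrix (Fin d) (Fin d) ℝ} (hM : M.PosDef) :
    ∫⁻ C, {C : Matrix (Fin d) (Fin d) ℝ | C.PosDef}.indicator (fun C =>
        ENNReal.ofReal (C.det ^ (β - ((d : ℝ) + 1) / 2) * Real.exp (-(C * M).trace))) C
          ∂symmLebesgue d =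
      ENNReal.ofReal (Real.pi ^ ((d : ℝ) * (d - 1) / 4) *
        (∏ l ∈ Finset.range d, Real.Gamma (β - l / 2)) * M.det ^ (-β)) := by
  induction d generalizing β with
  | zero =>
    rw [symmLebesgue_zero, lintegral_dirac' _ (measurable_gammaIntegrand _ _),
      Set.indicator_of_mem (show (0 : Matrix (Fin 0) (Fin 0) ℝ) ∈ {C | C.PosDef} from
        posDef_of_fin_zero 0)]
    simp [Matrix.trace]
  | succ d ih =>
    obtain ⟨s, m, M', hs, hM', rfl, hdet⟩ := exists_schur hM
    rw [hdet]
    push_cast at hβ ⊢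
    -- The exponent of the determinant must stay the same while the dimension drops by one, which
    -- forces `β` to become `β - 1/2`.
    have hβ' : ((d : ℝ) - 1) / 2 < β - 1 / 2 := by linarith
    have hβ0 : 0 < β := by have : (0 : ℝ) ≤ d := d.cast_nonneg; linarith
    set q := m ⬝ᵥ M'⁻¹ *ᵥ m
    set W := ∫⁻ C, {C : Matrix (Fin d) (Fin d) ℝ | C.PosDef}.indicator (fun C =>
        ENNReal.ofReal (C.det ^ (β - 1 / 2 - ((d : ℝ) + 1) / 2) * Real.exp (-(C * M').trace))) C
          ∂symmLebesgue d with hW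
    rw [lintegral_symmLebesgue_succ (measurable_gammaIntegrand _ _)]
    -- Shifting the block by `a⁻¹ b bᵀ` makes the determinant `a * D.det` and the domain `0 < a`
    -- with `D` positive definite. The trace then separates into terms in `a`, in `(a, b)` and in
    -- `D`. The null set `a = 0` is left out.
    have hinner : ∀ (a : ℝ) (b : Fin d → ℝ), a ≠ 0 →
        ∫⁻ D, {C : Matrix (Fin (d + 1)) (Fin (d + 1)) ℝ | C.PosDef}.indicator (fun C =>
          ENNReal.ofReal (C.det ^ (β - ((d : ℝ) + 1 + 1) / 2) *
            Real.exp (-(C * bordered (s + q) m M').trace))) (bordered a b D) ∂symmLebesgue d =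
        (Set.Ioi 0).indicator (fun a => ENNReal.ofReal (a ^ (β - ((d : ℝ) + 1 + 1) / 2) *
          Real.exp (-(a * (s + q)))) * (ENNReal.ofReal
            (Real.exp (-(a⁻¹ * (b ⬝ᵥ M' *ᵥ b) + 2 * (m ⬝ᵥ b)))) * W)) a := by
      intro a b ha
      have hA : (a⁻¹ • Matrix.vecMulVec b b)ᵀ = a⁻¹ • Matrix.vecMulVec b b := by
        rw [Matrix.transpose_smul, Matrix.transpose_vecMulVec]
      have hG := (measurable_gammaIntegrand (β - ((d : ℝ) + 1 + 1) / 2)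
        (bordered (s + q) m M')).comp ((measurable_bordered d).comp
          (measurable_const (a := a) |>.prodMk (measurable_const (a := b) |>.prodMk measurable_id)))
      refine (lintegral_symmLebesgue_add_right hG hA).symm.trans ?_
      simp only [Function.comp_apply, id_eq]
      by_cases hpos : 0 < a
      · rw [Set.indicator_of_mem (Set.mem_Ioi.2 hpos), hW,
          ← lintegral_const_mul _ (measurable_gammaIntegrand _ _),
          ← lintegral_const_mul _ (by exact (measurable_gammaIntegrand _ _).const_mul _)]
        refine lintegral_congr fun D => ?_
        by_cases hD : D.PosDef
        · have hmem : bordered a b (D + a⁻¹ • Matrix.vecMulVec b b) ∈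
              {C : Matrix (Fin (d + 1)) (Fin (d + 1)) ℝ | C.PosDef} :=
            (posDef_bordered_add_iff a b D ha).2 ⟨hpos, hD⟩
          rw [Set.indicator_of_mem hmem,
            Set.indicator_of_mem (show D ∈ {C : Matrix (Fin d) (Fin d) ℝ | C.PosDef} from hD),
            det_bordered_add a b D ha, trace_bordered_mul,
            Real.mul_rpow hpos.le hD.det_pos.le, Matrix.add_mul, Matrix.trace_add,
            Matrix.smul_mul, Matrix.trace_smul, Matrix.vecMulVec_mul, Matrix.trace_vecMulVec,
            ← ENNReal.ofReal_mul (Real.exp_pos _).le, ← ENNReal.ofReal_mul (by positivity)]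
          congr 1
          rw [dotProduct_comm b (b ᵥ* M'), ← Matrix.dotProduct_mulVec, show β - 1 / 2 - ((d : ℝ) + 1) / 2 =
            β - ((d : ℝ) + 1 + 1) / 2 by ring, smul_eq_mul]
          rw [show -(a * (s + q) + 2 * (m ⬝ᵥ b) + ((D * M').trace + a⁻¹ * (b ⬝ᵥ M' *ᵥ b))) =
              -(a * (s + q)) + (-(a⁻¹ * (b ⬝ᵥ M' *ᵥ b) + 2 * (m ⬝ᵥ b)) + -(D * M').trace) by ring,
            Real.exp_add, Real.exp_add]
          ring
        · have hmem : bordered a b (D + a⁻¹ • Matrix.vecMulVec b b) ∉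
              {C : Matrix (Fin (d + 1)) (Fin (d + 1)) ℝ | C.PosDef} :=
            fun h => hD ((posDef_bordered_add_iff a b D ha).1 h).2
          rw [Set.indicator_of_notMem hmem,
            Set.indicator_of_notMem (show D ∉ {C : Matrix (Fin d) (Fin d) ℝ | C.PosDef} from hD)]
          simp
      · rw [Set.indicator_of_notMem (by simpa using hpos)]
        have hmem : ∀ D, bordered a b (D + a⁻¹ • Matrix.vecMulVec b b) ∉
            {C : Matrix (Fin (d + 1)) (Fin (d + 1)) ℝ | C.PosDef} :=
          fun D h => hpos ((posDef_bordered_add_iff a b D ha).1 h).1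
        simp_rw [Set.indicator_of_notMem (hmem _), lintegral_zero]
    -- Completing the square in the border yields `exp (a * q)`, which cancels `q` in the corner
    -- term, and a factor `a ^ (d/2)`, which raises the power of `a` to `β - 1`.
    have houter : ∀ a : ℝ, a ≠ 0 → ∫⁻ b : Fin d → ℝ, ∫⁻ D,
        {C : Matrix (Fin (d + 1)) (Fin (d + 1)) ℝ | C.PosDef}.indicator (fun C =>
          ENNReal.ofReal (C.det ^ (β - ((d : ℝ) + 1 + 1) / 2) *
            Real.exp (-(C * bordered (s + q) m M').trace))) (bordered a b D) ∂symmLebesgue d =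
        (Set.Ioi 0).indicator (fun a => ENNReal.ofReal
          (Real.pi ^ ((d : ℝ) / 2) * M'.det ^ (-(1 / 2) : ℝ)) * W *
            ENNReal.ofReal (a ^ (β - 1) * Real.exp (-(s * a)))) a := by
      intro a ha
      simp_rw [hinner a _ ha]
      by_cases hpos : 0 < a
      · simp_rw [Set.indicator_of_mem (Set.mem_Ioi.2 hpos)]
        rw [lintegral_const_mul _ (by fun_prop), lintegral_mul_const _ (by fun_prop),
          lintegral_exp_neg_quadratic_add_linear hM' m hpos, Fintype.card_fin, ← mul_assoc,
          ← ENNReal.ofReal_mul (by positivity), mul_right_comm (ENNReal.ofReal _) W,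
          ← ENNReal.ofReal_mul
            (mul_nonneg (by positivity) (Real.rpow_nonneg hM'.det_pos.le _))]
        congr 2
        have e1 : a ^ (β - 1) = a ^ (β - ((d : ℝ) + 1 + 1) / 2) * a ^ ((d : ℝ) / 2) := by
          rw [← Real.rpow_add hpos]; ring_nf
        have e2 : Real.exp (-(s * a)) = Real.exp (-(a * (s + q))) * Real.exp (a * q) := by
          rw [← Real.exp_add]; ring_nf
        rw [e1, e2]; ring
      · simp [hpos]
    have hae : ∀ᵐ a : ℝ, a ≠ 0 := by simp [ae_iff]
    rw [lintegral_congr_ae (hae.mono houter), lintegral_indicator measurableSet_Ioi,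
      lintegral_const_mul _ (by fun_prop), lintegral_Ioi_rpow_mul_exp_neg hβ0 hs, hW, ih hβ' hM']
    have hd := hM'.det_pos
    have hG : 0 ≤ ∏ l ∈ Finset.range d, Real.Gamma (β - 1 / 2 - l / 2) :=
      Finset.prod_nonneg fun l hl => by
        have : (l : ℝ) + 1 ≤ d := by exact_mod_cast Finset.mem_range.1 hl
        exact (Real.Gamma_pos_of_pos (by linarith)).le
    rw [← ENNReal.ofReal_mul (by positivity), ← ENNReal.ofReal_mul (by positivity)]
    congr 1
    -- The corner supplies the Gamma factor with index zero; the shifted parameter `β - 1/2`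
    -- accounts for the others. The border contributes `π ^ (d/2)` and the missing `M'.det ^
    -- (-1/2)`.
    rw [Finset.prod_range_succ', Real.mul_rpow hs.le hd.le,
      show -β = -(1 / 2) + -(β - 1 / 2) by ring, Real.rpow_add hd,
      show ((d : ℝ) + 1) * (d + 1 - 1) / 4 = d / 2 + d * (d - 1) / 4 by ring,
      Real.rpow_add Real.pi_pos, Finset.prod_congr rfl fun (l : ℕ) _ =>
        show Real.Gamma (β - ((l + 1 : ℕ) : ℝ) / 2) = Real.Gamma (β - 1 / 2 - l / 2) by
          push_cast; ring_nf]
    simp only [Nat.cast_zero, zero_div, sub_zero]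
    ring_nf

/-! ### Laplace transforms -/

/-- The Laplace transform of a quadratic form of a centred Gaussian vector. -/
lemma lintegral_exp_quadratic_multivariateGaussian {ι : Type*} [Fintype ι] [DecidableEq ι]
    {S B : Matrix ι ι ℝ} (hS : S.PosDef) (hK : (S⁻¹ - (2 : ℝ) • B).PosDef) :
    ∫⁻ z, ENNReal.ofReal (Real.exp (z.ofLp ⬝ᵥ B *ᵥ z.ofLp)) ∂multivariateGaussian 0 S =
      ENNReal.ofReal ((S.det * (S⁻¹ - (2 : ℝ) • B).det) ^ (-(1 / 2) : ℝ)) := by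
  open scoped MatrixOrder in
  have hRt : (CFC.sqrt S)ᵀ = CFC.sqrt S := by
    rw [← Matrix.conjTranspose_eq_transpose_of_trivial]
    exact (Matrix.nonneg_iff_posSemidef.1 (CFC.sqrt_nonneg S)).isHermitian.eq
  open scoped MatrixOrder in
  have hRR : CFC.sqrt S * CFC.sqrt S = S := CFC.sqrt_mul_sqrt_self S hS.posSemidef.nonneg
  rw [multivariateGaussian, ← map_pi_eq_stdGaussian, Measure.map_map (by fun_prop) (by fun_prop),
    lintegral_map (by fun_prop) (by fun_prop), pi_gaussianReal_eq_withDensity]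
  set R := CFC.sqrt S
  have hRdet : R.det * R.det = S.det := by rw [← Matrix.det_mul, hRR]
  have hRu : IsUnit R := by
    rw [Matrix.isUnit_iff_isUnit_det]
    exact (left_ne_zero_of_mul (hRdet ▸ hS.det_pos.ne')).isUnit
  -- With `R * R = S` the change of variables by `R` turns `S⁻¹` into the identity, so the standard
  -- Gaussian exponent and the quadratic form merge into one positive definite form.
  have hRKR : R * (S⁻¹ - (2 : ℝ) • B) * R = 1 - (2 : ℝ) • (R * B * R) := by
    have : R * S⁻¹ * R = 1 := by
      rw [← hRR, Matrix.mul_inv_rev, ← mul_assoc, Matrix.mul_nonsing_inv, one_mul,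
        Matrix.nonsing_inv_mul] <;> exact (Matrix.isUnit_iff_isUnit_det _).1 hRu
    rw [Matrix.mul_sub, Matrix.sub_mul, this, Matrix.mul_smul, Matrix.smul_mul]
  have hpd : ((1 / 2 : ℝ) • (R * (S⁻¹ - (2 : ℝ) • B) * R)).PosDef := by
    refine Matrix.PosDef.smul ?_ (by norm_num)
    have := (Matrix.IsUnit.posDef_star_left_conjugate_iff hRu).2 hK
    rwa [Matrix.star_eq_conjTranspose, Matrix.conjTranspose_eq_transpose_of_trivial, hRt] at this
  have hdens : ∀ x : ι → ℝ, ENNReal.ofReal (∏ i, gaussianPDFReal 0 1 (x i)) *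
      ENNReal.ofReal (Real.exp ((R *ᵥ x) ⬝ᵥ B *ᵥ (R *ᵥ x))) =
      ENNReal.ofReal ((√(2 * Real.pi))⁻¹ ^ Fintype.card ι) *
        ENNReal.ofReal (Real.exp (-(x ⬝ᵥ ((1 / 2 : ℝ) • (R * (S⁻¹ - (2 : ℝ) • B) * R)) *ᵥ x))) := by
    intro x
    have hq : (R *ᵥ x) ⬝ᵥ B *ᵥ (R *ᵥ x) = x ⬝ᵥ (R * B * R) *ᵥ x := by
      rw [Matrix.mul_assoc, ← Matrix.mulVec_mulVec, ← Matrix.mulVec_mulVec,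
        Matrix.dotProduct_mulVec x R, ← Matrix.mulVec_transpose, hRt]
    rw [← ENNReal.ofReal_mul (Finset.prod_nonneg fun i _ => gaussianPDFReal_nonneg _ _ _),
      ← ENNReal.ofReal_mul (by positivity), hq, hRKR]
    congr 1
    simp only [gaussianPDFReal, Finset.prod_mul_distrib, Finset.prod_const, Finset.card_univ,
      NNReal.coe_one, mul_one, sub_zero, ← Real.exp_sum, mul_assoc, ← Real.exp_add,
      Matrix.smul_mulVec, Matrix.sub_mulVec, Matrix.one_mulVec, dotProduct_smul, dotProduct_sub,
      smul_eq_mul]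
    congr 2
    have hxx : x ⬝ᵥ x = ∑ i, x i ^ 2 := by simp_rw [sq]; rfl
    rw [← Finset.sum_div, Finset.sum_neg_distrib, hxx]
    ring
  have hmeas : Measurable fun x : ι → ℝ => ENNReal.ofReal (∏ i, gaussianPDFReal 0 1 (x i)) :=
    (Finset.measurable_prod _ fun i _ =>
      (measurable_gaussianPDFReal 0 1).comp (measurable_pi_apply i)).ennreal_ofReal
  rw [lintegral_withDensity_eq_lintegral_mul _ hmeas (by fun_prop)]
  simp only [Pi.mul_apply, Function.comp_apply, zero_add, Matrix.ofLp_toEuclideanCLM, hdens]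
  rw [lintegral_const_mul _ (by fun_prop), lintegral_exp_neg_quadratic hpd,
    ← ENNReal.ofReal_mul (by positivity), Matrix.det_smul, Matrix.det_mul, Matrix.det_mul,
    mul_right_comm R.det, hRdet, Real.mul_rpow (by positivity) (mul_pos hS.det_pos hK.det_pos).le]
  congr 1
  rw [← mul_assoc, ← mul_assoc]
  -- What remains is the normalisation: `(2π) ^ (-n/2)`, `π ^ (n/2)` and `2 ^ (n/2)` multiply to
  -- one.
  convert one_mul _
  have e1 : Real.pi ^ ((Fintype.card ι : ℝ) / 2) = √Real.pi ^ Fintype.card ι := by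
    rw [Real.sqrt_eq_rpow, ← Real.rpow_mul_natCast Real.pi_pos.le]
    ring_nf
  have e2 : ((1 / 2 : ℝ) ^ Fintype.card ι) ^ (-(1 / 2) : ℝ) = √2 ^ Fintype.card ι := by
    rw [Real.sqrt_eq_rpow, one_div, inv_pow, Real.inv_rpow (by positivity),
      ← Real.rpow_neg (by positivity), neg_neg, ← Real.rpow_natCast, ← Real.rpow_natCast,
      ← Real.rpow_mul (by norm_num), ← Real.rpow_mul (by norm_num), mul_comm]
  rw [e1, e2, Real.sqrt_mul (by norm_num), ← mul_pow, ← mul_pow]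
  have h2 : (0 : ℝ) < √2 := by positivity
  have hpi : 0 < √Real.pi := Real.sqrt_pos.2 Real.pi_pos
  rw [show (√2 * √Real.pi)⁻¹ * √Real.pi * √2 = 1 by field_simp, one_pow]

/-- The Laplace transform of the Wishart law. -/
lemma lintegral_exp_trace_wishart {N d : ℕ} (hd : d ≤ N) {V T : Matrix (Fin d) (Fin d) ℝ}
    (hV : V.PosDef) (hK : (V⁻¹ - (2 : ℝ) • T).PosDef) :
    ∫⁻ C, ENNReal.ofReal (Real.exp (C * T).trace) ∂wishart V N =
      ENNReal.ofReal ((V.det * (V⁻¹ - (2 : ℝ) • T).det) ^ (-(N : ℝ) / 2)) := by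
  have hM : ((1 / 2 : ℝ) • (V⁻¹ - (2 : ℝ) • T)).PosDef := hK.smul (by norm_num)
  have hβ : ((d : ℝ) - 1) / 2 < (N : ℝ) / 2 := by
    have : (d : ℝ) ≤ N := by exact_mod_cast hd
    linarith
  have hprod : ∏ l ∈ Finset.Icc 1 d, Real.Gamma (((N : ℝ) + 1 - l) / 2) =
      ∏ l ∈ Finset.range d, Real.Gamma ((N : ℝ) / 2 - l / 2) := by
    rw [← Finset.Ico_add_one_right_eq_Icc, Finset.prod_Ico_eq_prod_range]
    refine Finset.prod_congr (by simp) fun l _ => ?_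
    push_cast
    ring_nf
  have hΓ : 0 < ∏ l ∈ Finset.range d, Real.Gamma ((N : ℝ) / 2 - l / 2) :=
    Finset.prod_pos fun l hl => by
      have : (l : ℝ) + 1 ≤ d := by exact_mod_cast Finset.mem_range.1 hl
      exact Real.Gamma_pos_of_pos (by linarith)
  have hmeas : Measurable fun C : Matrix (Fin d) (Fin d) ℝ => wishartDensity V N C := by
    have h1 : Measurable fun C : Matrix (Fin d) (Fin d) ℝ => C.det :=
      Continuous.measurable (by fun_prop)
    have h2 : Measurable fun C : Matrix (Fin d) (Fin d) ℝ => (C * V⁻¹).trace :=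
      Continuous.measurable (by fun_prop)
    unfold wishartDensity
    fun_prop
  have hmeas' : Measurable fun C : Matrix (Fin d) (Fin d) ℝ => (C * T).trace :=
    Continuous.measurable (by fun_prop)
  rw [wishart, lintegral_withDensity_eq_lintegral_mul _ hmeas.ennreal_ofReal (by fun_prop),
    ← lintegral_indicator (measurableSet_setOf_posDef _)]
  set c : ℝ := V.det ^ (-(N : ℝ) / 2) / (2 ^ ((N : ℝ) * d / 2) *
    Real.pi ^ ((d : ℝ) * (d - 1) / 4) * ∏ l ∈ Finset.range d, Real.Gamma ((N : ℝ) / 2 - l / 2))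
    with hc
  have hc0 : 0 ≤ c := by have := hV.det_pos; positivity
  have key : ∀ C : Matrix (Fin d) (Fin d) ℝ, {C : Matrix (Fin d) (Fin d) ℝ | C.PosDef}.indicator
      ((fun C => ENNReal.ofReal (wishartDensity V N C)) *
        fun C => ENNReal.ofReal (Real.exp (C * T).trace)) C = ENNReal.ofReal c *
      {C : Matrix (Fin d) (Fin d) ℝ | C.PosDef}.indicator (fun C => ENNReal.ofReal
        (C.det ^ ((N : ℝ) / 2 - ((d : ℝ) + 1) / 2) *
          Real.exp (-(C * ((1 / 2 : ℝ) • (V⁻¹ - (2 : ℝ) • T))).trace))) C := by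
    intro C
    by_cases hC : C ∈ {C : Matrix (Fin d) (Fin d) ℝ | C.PosDef}
    · have hCd : 0 < C.det := Matrix.PosDef.det_pos hC
      rw [Set.indicator_of_mem hC, Set.indicator_of_mem hC, Pi.mul_apply,
        ← ENNReal.ofReal_mul' (Real.exp_pos _).le, ← ENNReal.ofReal_mul hc0, wishartDensity, hprod,
        hc]
      congr 1
      have e : Real.exp (-(C * ((1 / 2 : ℝ) • (V⁻¹ - (2 : ℝ) • T))).trace) =
          Real.exp (-(1 / 2) * (C * V⁻¹).trace) * Real.exp (C * T).trace := by
        rw [← Real.exp_add, Matrix.mul_smul, Matrix.mul_sub, Matrix.mul_smul, Matrix.trace_smul,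
          Matrix.trace_sub, Matrix.trace_smul, smul_eq_mul, smul_eq_mul]
        ring_nf
      rw [e, show ((N : ℝ) - d - 1) / 2 = (N : ℝ) / 2 - ((d : ℝ) + 1) / 2 by ring]
      ring
    · rw [Set.indicator_of_notMem hC, Set.indicator_of_notMem hC, mul_zero]
  rw [lintegral_congr key, lintegral_const_mul _ (measurable_gammaIntegrand _ _),
    lintegral_posDef_det_rpow_mul_exp hβ hM, ← ENNReal.ofReal_mul hc0, Matrix.det_smul,
    Fintype.card_fin, Real.mul_rpow (by positivity) hK.det_pos.le,
    Real.mul_rpow hV.det_pos.le hK.det_pos.le]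
  congr 1
  have e2 : ((1 / 2 : ℝ) ^ d) ^ (-((N : ℝ) / 2)) = 2 ^ ((N : ℝ) * d / 2) := by
    rw [one_div, inv_pow, Real.inv_rpow (by positivity), ← Real.rpow_neg (by positivity), neg_neg,
      ← Real.rpow_natCast, ← Real.rpow_mul (by norm_num)]
    ring_nf
  rw [e2, hc, neg_div]
  have hpi : (0 : ℝ) < Real.pi ^ ((d : ℝ) * (d - 1) / 4) := by positivity
  generalize ∏ l ∈ Finset.range d, Real.Gamma ((N : ℝ) / 2 - l / 2) = G at hΓ ⊢
  field_simp

/-- Finite measures with the same finite Laplace transform near the origin coincide. -/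
theorem ext_of_eventually_lintegral_exp_eq {E : Type*} [NormedAddCommGroup E] [NormedSpace ℝ E]
    [MeasurableSpace E] [BorelSpace E] [SecondCountableTopology E] [CompleteSpace E]
    {μ ν : Measure E} [IsFiniteMeasure μ] [IsFiniteMeasure ν]
    (h : ∀ L : StrongDual ℝ E, ∀ᶠ s in nhds (0 : ℝ),
      ∫⁻ x, ENNReal.ofReal (Real.exp (s * L x)) ∂μ = ∫⁻ x, ENNReal.ofReal (Real.exp (s * L x)) ∂ν ∧
      ∫⁻ x, ENNReal.ofReal (Real.exp (s * L x)) ∂μ ≠ ∞) : μ = ν := by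
  refine Measure.ext_of_charFunDual (funext fun L => ?_)
  have hint : ∀ (ρ : Measure E) (s : ℝ), ∫⁻ x, ENNReal.ofReal (Real.exp (s * L x)) ∂ρ ≠ ∞ →
      Integrable (fun x => Real.exp (s * L x)) ρ := fun ρ s hs =>
    ⟨by fun_prop, by
      rwa [hasFiniteIntegral_iff_ofReal (Filter.Eventually.of_forall fun x => (Real.exp_pos _).le),
        lt_top_iff_ne_top]⟩
  have hμ : 0 ∈ interior (integrableExpSet L μ) :=
    mem_interior_iff_mem_nhds.2 ((h L).mono fun s hs => hint μ s hs.2)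
  have hν : 0 ∈ interior (integrableExpSet L ν) :=
    mem_interior_iff_mem_nhds.2 ((h L).mono fun s hs => hint ν s (hs.1 ▸ hs.2))
  have hmgf : ∀ᶠ s in nhds (0 : ℝ), mgf L μ s = mgf L ν s := (h L).mono fun s hs => by
    simp only [mgf]
    rw [integral_eq_lintegral_of_nonneg_ae
        (Filter.Eventually.of_forall fun x => (Real.exp_pos _).le) (by fun_prop),
      integral_eq_lintegral_of_nonneg_ae
        (Filter.Eventually.of_forall fun x => (Real.exp_pos _).le) (by fun_prop), hs.1]
  -- A vertical strip around the imaginary axis on which both complex moment generating functions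
  -- are analytic. They agree at real points near zero, hence throughout, and at `I` they are the
  -- characteristic functions.
  set U : Set ℂ := {z | z.re ∈ interior (integrableExpSet L μ) ∩ interior (integrableExpSet L ν)}
  have hU : IsPreconnected U :=
    ((convex_integrableExpSet.interior.inter convex_integrableExpSet.interior).linear_preimage
      Complex.reLm).isPreconnected
  have hX : AnalyticOnNhd ℂ (complexMGF L μ) U :=
    analyticOnNhd_complexMGF.mono fun z hz => hz.1
  have hY : AnalyticOnNhd ℂ (complexMGF L ν) U :=
    analyticOnNhd_complexMGF.mono fun z hz => hz.2
  have hfreq : ∃ᶠ z in nhdsWithin (0 : ℂ) {0}ᶜ, complexMGF L μ z = complexMGF L ν z := by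
    have ht : Filter.Tendsto (fun s : ℝ => (s : ℂ)) (nhdsWithin 0 {0}ᶜ)
        (nhdsWithin (0 : ℂ) {0}ᶜ) := by
      refine tendsto_nhdsWithin_iff.2 ⟨?_, ?_⟩
      · exact (Complex.continuous_ofReal.tendsto' 0 0 rfl).mono_left nhdsWithin_le_nhds
      · filter_upwards [self_mem_nhdsWithin] with s hs
        simpa using hs
    refine ht.frequently (Filter.Eventually.frequently ?_)
    filter_upwards [nhdsWithin_le_nhds hmgf] with s hs
    rw [complexMGF_ofReal, complexMGF_ofReal, hs]
  have heq := hX.eqOn_of_preconnected_of_frequently_eq hY hU (z₀ := 0) ⟨hμ, hν⟩ hfreq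
    (x := Complex.I) ⟨by simpa using hμ, by simpa using hν⟩
  simp only [complexMGF] at heq
  rw [charFunDual_apply, charFunDual_apply]
  simpa only [mul_comm Complex.I] using heq

/-- Positive definiteness is stable under small symmetric perturbations. -/
lemma eventually_posDef_sub_smul {ι : Type*} [Fintype ι] {A T : Matrix ι ι ℝ}
    (hA : A.PosDef) (hT : Tᵀ = T) : ∀ᶠ s in nhds (0 : ℝ), (A - s • T).PosDef := by
  -- Compactness of the unit sphere makes the bound on `s` uniform in `x`; homogeneity then extends
  -- positivity to all nonzero vectors.
  have h1 : ∀ᶠ s in nhds (0 : ℝ), ∀ x ∈ Metric.sphere (0 : ι → ℝ) 1,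
      0 < x ⬝ᵥ (A - s • T) *ᵥ x := by
    refine (isCompact_sphere _ _).eventually_forall_of_forall_eventually fun x hx => ?_
    have hc : Continuous fun p : ℝ × (ι → ℝ) => p.2 ⬝ᵥ (A - p.1 • T) *ᵥ p.2 := by fun_prop
    refine hc.continuousAt.eventually (lt_mem_nhds ?_)
    have hx0 : x ≠ 0 := by rintro rfl; simp at hx
    simpa using hA.dotProduct_mulVec_pos hx0
  filter_upwards [h1] with s hs
  refine Matrix.PosDef.of_dotProduct_mulVec_pos ?_ fun x hx => ?_
  · have : Aᵀ = A := by simpa using hA.isHermitian.eq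
    rw [Matrix.IsHermitian, Matrix.conjTranspose_eq_transpose_of_trivial, Matrix.transpose_sub,
      Matrix.transpose_smul, this, hT]
  · have hn : 0 < ‖x‖ := norm_pos_iff.2 hx
    have := hs (‖x‖⁻¹ • x) (by simp [norm_smul, hn.ne'])
    rw [Matrix.mulVec_smul, dotProduct_smul, smul_dotProduct, smul_eq_mul, smul_eq_mul] at this
    rw [star_trivial]
    exact pos_of_mul_pos_right (pos_of_mul_pos_right this (by positivity)) (by positivity)

/-! ### The law of the sample covariance matrix -/

lemma isProbabilityMeasure_wishart {N d : ℕ} (hd : d ≤ N) {V : Matrix (Fin d) (Fin d) ℝ}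
    (hV : V.PosDef) : IsProbabilityMeasure (wishart V N) := by
  have h := lintegral_exp_trace_wishart hd (T := 0) hV (by simpa using hV.inv)
  refine ⟨?_⟩
  rw [smul_zero, sub_zero, Matrix.det_nonsing_inv, Ring.inverse_eq_inv',
    mul_inv_cancel₀ hV.det_pos.ne', Real.one_rpow] at h
  simpa using h

lemma ae_wishart_posDef {d : ℕ} (V : Matrix (Fin d) (Fin d) ℝ) (N : ℕ) :
    ∀ᵐ C ∂wishart V N, C.PosDef :=
  (withDensity_absolutelyContinuous _ _).ae_le (ae_restrict_mem (measurableSet_setOf_posDef _))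

lemma measurable_sampleCov {N d : ℕ} : Measurable (sampleCov (N := N) (d := d)) :=
  Continuous.measurable (by unfold sampleCov; fun_prop)

lemma measurable_gram {N d : ℕ} : Measurable (gram (N := N) (d := d)) :=
  Continuous.measurable (by unfold gram; fun_prop)

lemma transpose_sampleCov {N d : ℕ} (Z : Matrix (Fin N) (Fin d) ℝ) :
    (sampleCov Z)ᵀ = sampleCov Z := by
  simp [sampleCov, Matrix.transpose_mul]

/-- Writes a linear functional of the sample covariance as a sum over rows, so that its exponential
factorises under independence. -/
lemma trace_sampleCov_mul {N d : ℕ} (Z : Matrix (Fin N) (Fin d) ℝ) (T : Matrix (Fin d) (Fin d) ℝ) :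
    (sampleCov Z * T).trace = ∑ i, Z i ⬝ᵥ ((N : ℝ)⁻¹ • T) *ᵥ Z i := by
  rw [sampleCov, Matrix.smul_mul, Matrix.trace_smul, Matrix.mul_assoc, Matrix.trace_mul_comm,
    Matrix.trace, smul_eq_mul, Finset.mul_sum]
  refine Finset.sum_congr rfl fun i _ => ?_
  rw [Matrix.smul_mulVec, dotProduct_smul, smul_eq_mul, Matrix.dotProduct_mulVec, Matrix.diag_apply]
  rfl

section

variable {Ω : Type*} [MeasurableSpace Ω] {P : Measure Ω}

/-- The Laplace transform of the sample covariance matrix of Gaussian rows. -/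
lemma lintegral_exp_trace_sampleCov {N d : ℕ} {Z : Ω → Matrix (Fin N) (Fin d) ℝ}
    {S T : Matrix (Fin d) (Fin d) ℝ} (hS : S.PosDef)
    (hind : iIndepFun (fun i ω => WithLp.toLp 2 (Z ω i)) P)
    (hlaw : ∀ i, HasLaw (fun ω => WithLp.toLp 2 (Z ω i)) (multivariateGaussian 0 S) P)
    (hK : (S⁻¹ - (2 : ℝ) • ((N : ℝ)⁻¹ • T)).PosDef) :
    ∫⁻ ω, ENNReal.ofReal (Real.exp (sampleCov (Z ω) * T).trace) ∂P =
      ENNReal.ofReal ((S.det * (S⁻¹ - (2 : ℝ) • ((N : ℝ)⁻¹ • T)).det) ^ (-(N : ℝ) / 2)) := by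
  have hpi := hind.hasLaw_pi hlaw
  set g : EuclideanSpace ℝ (Fin d) → ℝ≥0∞ := fun z =>
    ENNReal.ofReal (Real.exp (z.ofLp ⬝ᵥ ((N : ℝ)⁻¹ • T) *ᵥ z.ofLp)) with hg
  have hgm : Measurable g := by fun_prop
  have h1 : ∀ ω, ENNReal.ofReal (Real.exp (sampleCov (Z ω) * T).trace) =
      (fun z : Fin N → EuclideanSpace ℝ (Fin d) => ∏ i, g (z i))
        (fun i => WithLp.toLp 2 (Z ω i)) := fun ω => by
    rw [trace_sampleCov_mul, Real.exp_sum,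
      ENNReal.ofReal_prod_of_nonneg fun i _ => (Real.exp_pos _).le]
  simp_rw [h1]
  rw [hpi.lintegral_comp (f := fun z : Fin N → EuclideanSpace ℝ (Fin d) => ∏ i, g (z i))
    (Finset.measurable_prod _ fun i _ => hgm.comp (measurable_pi_apply i)).aemeasurable,
    lintegral_prod_eq_prod_lintegral_of_indepFun Finset.univ
      (fun i (z : Fin N → EuclideanSpace ℝ (Fin d)) => g (z i))
      (iIndepFun_pi fun i => hgm.aemeasurable)
      fun i => hgm.comp (measurable_pi_apply i)]
  have h2 : ∀ i : Fin N, ∫⁻ z : Fin N → EuclideanSpace ℝ (Fin d), g (z i)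
      ∂(Measure.pi fun _ => multivariateGaussian 0 S) =
      ENNReal.ofReal ((S.det * (S⁻¹ - (2 : ℝ) • ((N : ℝ)⁻¹ • T)).det) ^ (-(1 / 2) : ℝ)) := fun i => by
    rw [(measurePreserving_eval (fun _ => multivariateGaussian 0 S) i).lintegral_comp hgm, hg,
      lintegral_exp_quadratic_multivariateGaussian hS hK]
  have hpos := mul_pos hS.det_pos hK.det_pos
  rw [Finset.prod_congr rfl fun i _ => h2 i, Finset.prod_const, Finset.card_univ, Fintype.card_fin,
    ← ENNReal.ofReal_pow (by positivity), ← Real.rpow_mul_natCast hpos.le]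
  ring_nf

open scoped Matrix.Norms.L2Operator in
/-- The sample covariance matrix of independent centred Gaussian rows has the Wishart law. -/
theorem hasLaw_sampleCov_wishart [IsProbabilityMeasure P] {N d : ℕ} {Z : Ω → Matrix (Fin N) (Fin d) ℝ}
    (hZ : AEMeasurable Z P) {S : Matrix (Fin d) (Fin d) ℝ} (hS : S.PosDef) (hd : d ≤ N)
    (hind : iIndepFun (fun i ω => WithLp.toLp 2 (Z ω i)) P)
    (hlaw : ∀ i, HasLaw (fun ω => WithLp.toLp 2 (Z ω i)) (multivariateGaussian 0 S) P) :
    HasLaw (fun ω => sampleCov (Z ω)) (wishart ((N : ℝ)⁻¹ • S) N) P := by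
  have hV : ((N : ℝ)⁻¹ • S).PosDef := by
    rcases Nat.eq_zero_or_pos d with rfl | hd0
    · exact posDef_of_fin_zero _
    · have : (0 : ℝ) < N := by exact_mod_cast hd0.trans_le hd
      exact hS.smul (inv_pos.2 this)
  have hC : AEMeasurable (fun ω => sampleCov (Z ω)) P := measurable_sampleCov.comp_aemeasurable hZ
  refine ⟨hC, ?_⟩
  have := isProbabilityMeasure_wishart hd hV
  have := Measure.isProbabilityMeasure_map hC
  refine ext_of_eventually_lintegral_exp_eq fun L => ?_
  set T₀ : Matrix (Fin d) (Fin d) ℝ := Matrix.of fun j i => L (Matrix.single i j 1) with hT₀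
  -- `T₀` represents `L` in the trace pairing. Its symmetric part represents the same functional on
  -- symmetric matrices, and symmetry is needed for the perturbed inverses to be positive definite.
  set T : Matrix (Fin d) (Fin d) ℝ := (1 / 2 : ℝ) • (T₀ + T₀ᵀ) with hTdef
  have hT : Tᵀ = T := by
    rw [hTdef, Matrix.transpose_smul, Matrix.transpose_add, Matrix.transpose_transpose, add_comm]
  have hL : ∀ C : Matrix (Fin d) (Fin d) ℝ, Cᵀ = C → L C = (C * T).trace := fun C hCt => by
    have h1 : L C = (C * T₀).trace := by
      conv_lhs => rw [Matrix.matrix_eq_sum_single C]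
      simp only [map_sum, Matrix.trace, Matrix.diag_apply, Matrix.mul_apply, hT₀, Matrix.of_apply]
      refine Finset.sum_congr rfl fun i _ => Finset.sum_congr rfl fun j _ => ?_
      rw [← smul_eq_mul (C i j), ← map_smul, Matrix.smul_single, smul_eq_mul, mul_one]
    have h2 : (C * T₀ᵀ).trace = (C * T₀).trace := by
      rw [← Matrix.trace_transpose, Matrix.transpose_mul, Matrix.transpose_transpose, hCt,
        Matrix.trace_mul_comm]
    rw [hTdef, Matrix.mul_smul, Matrix.mul_add, Matrix.trace_smul, Matrix.trace_add, h2, h1,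
      smul_eq_mul]
    ring
  have e1 := eventually_posDef_sub_smul hS.inv
    (T := (2 : ℝ) • ((N : ℝ)⁻¹ • T)) (by simp only [Matrix.transpose_smul, hT])
  have e2 := eventually_posDef_sub_smul hV.inv
    (T := (2 : ℝ) • T) (by simp only [Matrix.transpose_smul, hT])
  filter_upwards [e1, e2] with s hs1 hs2
  have hs1' : (S⁻¹ - (2 : ℝ) • ((N : ℝ)⁻¹ • (s • T))).PosDef := by
    convert hs1 using 2
    module
  have hs2' : (((N : ℝ)⁻¹ • S)⁻¹ - (2 : ℝ) • (s • T)).PosDef := by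
    rwa [smul_comm]
  have hmL : Measurable fun C : Matrix (Fin d) (Fin d) ℝ => ENNReal.ofReal (Real.exp (s * L C)) := by
    have : Measurable fun C : Matrix (Fin d) (Fin d) ℝ => L C := L.continuous.measurable
    fun_prop
  have hsmul : ∀ C : Matrix (Fin d) (Fin d) ℝ, s * (C * T).trace = (C * (s • T)).trace := fun C => by
    rw [Matrix.mul_smul C s T, Matrix.trace_smul, smul_eq_mul]
  have l1 : ∫⁻ C, ENNReal.ofReal (Real.exp (s * L C)) ∂(P.map fun ω => sampleCov (Z ω)) =
      ENNReal.ofReal ((S.det * (S⁻¹ - (2 : ℝ) • ((N : ℝ)⁻¹ • (s • T))).det) ^ (-(N : ℝ) / 2)) := by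
    rw [lintegral_map' hmL.aemeasurable hC, ← lintegral_exp_trace_sampleCov hS hind hlaw hs1']
    refine lintegral_congr fun ω => ?_
    rw [hL _ (transpose_sampleCov _), hsmul]
  have l2 : ∫⁻ C, ENNReal.ofReal (Real.exp (s * L C)) ∂(wishart ((N : ℝ)⁻¹ • S) N) =
      ENNReal.ofReal ((((N : ℝ)⁻¹ • S).det *
        (((N : ℝ)⁻¹ • S)⁻¹ - (2 : ℝ) • (s • T)).det) ^ (-(N : ℝ) / 2)) := by
    rw [← lintegral_exp_trace_wishart hd hV hs2']
    refine lintegral_congr_ae ((ae_wishart_posDef _ _).mono fun C hCp => ?_)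
    simp only []
    rw [hL C (by simpa using hCp.isHermitian.eq), hsmul]
  refine ⟨?_, l1 ▸ ENNReal.ofReal_ne_top⟩
  -- Multiplying each determinant pair together gives the determinant of `1 - (2 s / N) S T` on both
  -- sides.
  rw [l1, l2, ← Matrix.det_mul, ← Matrix.det_mul, Matrix.mul_sub, Matrix.mul_sub,
    Matrix.mul_nonsing_inv _ hS.det_pos.ne'.isUnit, Matrix.mul_nonsing_inv _ hV.det_pos.ne'.isUnit]
  simp only [Matrix.mul_smul, Matrix.smul_mul, smul_smul]
  ring_nf

end

/-! ### The estimator -/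

lemma act_add {n d : ℕ} (A : Matrix (Fin n) (Fin d) ℝ)
    (x y : EuclideanSpace ℝ (Fin d)) : act A (x + y) = act A x + act A y := by
  simp [act, Matrix.mulVec_add]

lemma act_act {n m d : ℕ} (A : Matrix (Fin n) (Fin m) ℝ) (B : Matrix (Fin m) (Fin d) ℝ)
    (x : EuclideanSpace ℝ (Fin d)) : act A (act B x) = act (A * B) x := by
  simp [act, Matrix.mulVec_mulVec]

lemma inner_act_left {n d : ℕ} (A : Matrix (Fin n) (Fin d) ℝ)
    (x : EuclideanSpace ℝ (Fin d)) (y : EuclideanSpace ℝ (Fin n)) :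
    inner ℝ (act A x) y = inner ℝ x (act Aᵀ y) := by
  simp only [act, EuclideanSpace.inner_eq_star_dotProduct, star_trivial]
  rw [Matrix.dotProduct_mulVec, Matrix.mulVec_transpose]

lemma continuous_act_uncurry {n d : ℕ} :
    Continuous fun p : Matrix (Fin n) (Fin d) ℝ × EuclideanSpace ℝ (Fin d) => act p.1 p.2 := by
  unfold act
  fun_prop

/-- The energy splits off a quadratic form around the estimator. -/
lemma energy_eq_add {N d : ℕ} {σ2 η : ℝ} (hσ2 : 0 < σ2) (X : Matrix (Fin N) (Fin d) ℝ)
    (t : EuclideanSpace ℝ (Fin N)) (h : IsUnit (reg (σ2 * η) (gram X)).det)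
    (θ : EuclideanSpace ℝ (Fin d)) :
    energy σ2 η X t θ = energy σ2 η X t (mapEstimator σ2 η X t) +
      1 / (2 * σ2) * (‖act X (θ - mapEstimator σ2 η X t)‖ ^ 2 +
        σ2 * η * ‖θ - mapEstimator σ2 η X t‖ ^ 2) := by
  set u := mapEstimator σ2 η X t with hu
  -- The normal equations: the gradient of the energy vanishes at `u`, so only the quadratic
  -- remainder survives below.
  have hnormal : act Xᵀ (act X u) + (σ2 * η) • u = act Xᵀ t := by
    have h1 : act (reg (σ2 * η) (gram X)) u = act Xᵀ t := by
      rw [hu, mapEstimator, act_act, ← Matrix.mul_assoc, Matrix.mul_nonsing_inv _ h, Matrix.one_mul]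
    rw [← h1, act_act]
    simp [act, reg, gram, Matrix.add_mulVec, Matrix.smul_mulVec]
  obtain ⟨v, rfl⟩ : ∃ v, θ = u + v := ⟨θ - u, by abel⟩
  rw [add_sub_cancel_left, energy, energy, act_add, ← sub_sub,
    norm_sub_sq_real (t - act X u) (act X v), norm_add_sq_real u v]
  have hcross : inner ℝ (t - act X u) (act X v) = σ2 * η * inner ℝ u v := by
    rw [real_inner_comm, inner_act_left, show act Xᵀ (t - act X u) = (σ2 * η) • u by
      rw [eq_comm, ← sub_eq_iff_eq_add'.2 hnormal.symm]; simp [act, Matrix.mulVec_sub],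
      real_inner_smul_right, real_inner_comm]
  rw [hcross]
  field_simp
  ring

/-- The estimator is the unique minimiser of the energy. -/
theorem isMinOn_energy_iff {N d : ℕ} {σ2 η : ℝ} (hσ2 : 0 < σ2) (hη : 0 ≤ η)
    (X : Matrix (Fin N) (Fin d) ℝ) (t : EuclideanSpace ℝ (Fin N))
    (h : IsUnit (reg (σ2 * η) (gram X)).det) (θ : EuclideanSpace ℝ (Fin d)) :
    IsMinOn (energy σ2 η X t) Set.univ θ ↔ θ = mapEstimator σ2 η X t := by
  have hη' : 0 ≤ σ2 * η := by positivity
  constructor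
  · intro hmin
    have h1 : energy σ2 η X t θ ≤ energy σ2 η X t (mapEstimator σ2 η X t) := hmin (Set.mem_univ _)
    rw [energy_eq_add hσ2 X t h θ] at h1
    set v := θ - mapEstimator σ2 η X t with hv
    have h2 : ‖act X v‖ ^ 2 + σ2 * η * ‖v‖ ^ 2 = 0 := by
      refine le_antisymm ?_ (by positivity)
      have : 1 / (2 * σ2) * (‖act X v‖ ^ 2 + σ2 * η * ‖v‖ ^ 2) ≤ 0 := by linarith
      exact nonpos_of_mul_nonpos_right this (by positivity)
    -- Since `η` may vanish, the penalty alone cannot force `v = 0`. Both terms vanishing gives `reg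
    -- (σ2 * η) (gram X)` applied to `v` equal to zero, and invertibility finishes.
    have h3 : act X v = 0 := by
      have : ‖act X v‖ ^ 2 = 0 := by nlinarith [sq_nonneg ‖act X v‖, mul_nonneg hη' (sq_nonneg ‖v‖)]
      simpa using this
    have h4 : (σ2 * η) • v = 0 := by
      rw [h3] at h2
      rcases mul_eq_zero.1 (by simpa using h2 : σ2 * η * ‖v‖ ^ 2 = 0) with h5 | h5
      · rw [h5, zero_smul]
      · rw [show v = 0 by simpa using h5, smul_zero]
    have h5 : act (reg (σ2 * η) (gram X)) v = 0 := by
      have : act (reg (σ2 * η) (gram X)) v = act Xᵀ (act X v) + (σ2 * η) • v := by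
        rw [act_act]; simp [act, reg, gram, Matrix.add_mulVec, Matrix.smul_mulVec]
      rw [this, h3, h4]; simp [act]
    have h6 : v = 0 := by
      have : act ((reg (σ2 * η) (gram X))⁻¹) (act (reg (σ2 * η) (gram X)) v) = v := by
        rw [act_act, Matrix.nonsing_inv_mul _ h]; simp [act]
      rw [← this, h5]; simp [act]
    exact sub_eq_zero.1 h6
  · rintro rfl θ' -
    rw [Set.mem_ofPred_eq, energy_eq_add hσ2 X t h θ']
    exact le_add_of_nonneg_right (by positivity)

/-! ### Conditional law of the estimator given the design -/

lemma measurable_reg {d : ℕ} (c : ℝ) : Measurable (reg (d := d) c) :=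
  Continuous.measurable (by unfold reg; fun_prop)

lemma measurable_mapEstimator {N d : ℕ} (σ2 η : ℝ) (θ0 : EuclideanSpace ℝ (Fin d)) :
    Measurable fun p : Matrix (Fin N) (Fin d) ℝ × EuclideanSpace ℝ (Fin N) =>
      mapEstimator σ2 η p.1 (act p.1 θ0 + p.2) := by
  have hact : ∀ n m : ℕ, Measurable fun p : Matrix (Fin n) (Fin m) ℝ × EuclideanSpace ℝ (Fin m) =>
      act p.1 p.2 := fun n m => continuous_act_uncurry.measurable
  have hinv : Measurable fun X : Matrix (Fin N) (Fin d) ℝ => (reg (σ2 * η) (gram X))⁻¹ :=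
    (measurable_matrix_inv _).comp ((measurable_reg _).comp measurable_gram)
  have hmul : Measurable fun p : Matrix (Fin d) (Fin d) ℝ × Matrix (Fin N) (Fin d) ℝ =>
      p.1 * p.2ᵀ := Continuous.measurable (by fun_prop)
  have h1 : Measurable fun p : Matrix (Fin N) (Fin d) ℝ × EuclideanSpace ℝ (Fin N) =>
      (reg (σ2 * η) (gram p.1))⁻¹ * p.1ᵀ :=
    hmul.comp ((hinv.comp measurable_fst).prodMk measurable_fst)
  have h2 : Measurable fun p : Matrix (Fin N) (Fin d) ℝ × EuclideanSpace ℝ (Fin N) =>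
      act p.1 θ0 + p.2 := ((hact _ _).comp (measurable_fst.prodMk measurable_const)).add measurable_snd
  exact (hact _ _).comp (h1.prodMk h2)

/-- Affine images of isotropic Gaussian noise. -/
lemma map_affine_multivariateGaussian {n d : ℕ} {s : ℝ} (hs : 0 ≤ s)
    (m : EuclideanSpace ℝ (Fin d)) (B : Matrix (Fin d) (Fin n) ℝ) :
    (multivariateGaussian 0 (s • (1 : Matrix (Fin n) (Fin n) ℝ))).map (fun e => m + act B e) =
      multivariateGaussian m (s • (B * Bᵀ)) := by
  have hB : (s • (B * Bᵀ)).PosSemidef := by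
    have := (Matrix.posSemidef_self_mul_conjTranspose B).smul hs
    rwa [Matrix.conjTranspose_eq_transpose_of_trivial] at this
  have hm : Measurable fun e : EuclideanSpace ℝ (Fin n) => m + act B e :=
    ((continuous_act_uncurry.measurable).comp (measurable_const.prodMk measurable_id)).const_add m
  have := Measure.isProbabilityMeasure_map (μ := multivariateGaussian 0
    (s • (1 : Matrix (Fin n) (Fin n) ℝ))) hm.aemeasurable
  refine Measure.ext_of_charFun (funext fun t => ?_)
  rw [charFun_multivariateGaussian hB, charFun_apply, integral_map hm.aemeasurable (by fun_prop)]
  simp_rw [inner_add_left, inner_act_left, Complex.ofReal_add, add_mul, Complex.exp_add]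
  rw [integral_const_mul, ← charFun_apply,
    charFun_multivariateGaussian (Matrix.PosSemidef.one.smul hs), ← Complex.exp_add,
    real_inner_comm, inner_zero_right]
  congr 1
  simp only [act, Matrix.smul_mulVec, Matrix.one_mulVec, dotProduct_smul, smul_eq_mul,
    ← Matrix.mulVec_mulVec, Matrix.dotProduct_mulVec _ B, ← Matrix.mulVec_transpose]
  push_cast
  ring

/-- A singular matrix has inverse zero by convention, so commutation holds without any invertibility
assumption. -/
lemma commute_inv_reg {d : ℕ} (c : ℝ) (A : Matrix (Fin d) (Fin d) ℝ) : Commute (reg c A)⁻¹ A := by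
  by_cases h : IsUnit (reg c A).det
  · have h1 : Commute (reg c A) A :=
      (Commute.refl A).add_left ((Commute.one_left A).smul_left c)
    have h2 := congrArg (fun M => (reg c A)⁻¹ * M * (reg c A)⁻¹) h1.eq
    simp only [← mul_assoc, Matrix.nonsing_inv_mul _ h, one_mul] at h2
    rw [mul_assoc _ (reg c A), Matrix.mul_nonsing_inv _ h, mul_one] at h2
    exact h2.symm
  · rw [Matrix.nonsing_inv_apply_not_isUnit _ h]
    exact Commute.zero_left A

/-- Given the design, the estimator has the component law. -/
lemma map_mapEstimator_eq_componentLaw {N d : ℕ} (σ2 η : ℝ) {s : ℝ} (hs : 0 ≤ s)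
    (θ0 : EuclideanSpace ℝ (Fin d)) (X : Matrix (Fin N) (Fin d) ℝ) :
    (multivariateGaussian 0 (s • (1 : Matrix (Fin N) (Fin N) ℝ))).map
      (fun e => mapEstimator σ2 η X (act X θ0 + e)) = componentLaw θ0 (σ2 * η) s (gram X) := by
  have hsymm : ((reg (σ2 * η) (gram X))⁻¹)ᵀ = (reg (σ2 * η) (gram X))⁻¹ := by
    rw [Matrix.transpose_nonsing_inv]
    simp [reg, gram, Matrix.transpose_mul]
  have hcomm := commute_inv_reg (σ2 * η) (gram X)
  simp only [mapEstimator, act_add, act_act]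
  rw [map_affine_multivariateGaussian hs, componentLaw, Matrix.transpose_mul,
    Matrix.transpose_transpose, hsymm]
  simp only [gram] at hcomm ⊢
  congr 2
  · rw [Matrix.mul_assoc]
  · rw [sq, Matrix.mul_assoc _ Xᵀ, ← Matrix.mul_assoc Xᵀ, ← hcomm.eq, Matrix.mul_assoc]

/-! ### Measurable dependence of the normal laws on the matrix -/

lemma measurable_measure_map {α β γ : Type*} [MeasurableSpace α] [MeasurableSpace β]
    [MeasurableSpace γ] {F : α × β → γ} (hF : Measurable F) (ν : Measure β) [SFinite ν] :
    Measurable fun a => ν.map fun b => F (a, b) := by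
  refine Measure.measurable_of_measurable_coe _ fun B hB => ?_
  have h : ∀ a, (ν.map fun b => F (a, b)) B = ν (Prod.mk a ⁻¹' (F ⁻¹' B)) := fun a =>
    Measure.map_apply (hF.comp measurable_prodMk_left) hB
  simp_rw [h]
  exact measurable_measure_prodMk_left (hF hB)

-- The square root is continuous on the closed semidefinite cone and takes the default value zero
-- off it.
open scoped Matrix.Norms.L2Operator MatrixOrder in
lemma measurable_cfc_sqrt (d : ℕ) : Measurable fun C : Matrix (Fin d) (Fin d) ℝ => CFC.sqrt C := by
  have h : ContinuousOn CFC.sqrt {C : Matrix (Fin d) (Fin d) ℝ | 0 ≤ C} := CFC.continuousOn_sqrt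
  have h' : {C : Matrix (Fin d) (Fin d) ℝ | 0 ≤ C} = {C | C.PosSemidef} := by
    ext C; exact Matrix.nonneg_iff_posSemidef
  rw [h'] at h
  refine measurable_of_restrict_of_restrict_compl (isClosed_setOf_posSemidef _).measurableSet
    h.domRestrict.measurable ?_
  convert measurable_const (a := (0 : Matrix (Fin d) (Fin d) ℝ)) using 1
  ext1 C
  rw [Set.domRestrict_apply, CFC.sqrt, cfcₙ_apply_of_not_predicate]
  exact fun hC => C.2 (by simpa using Matrix.nonneg_iff_posSemidef.1 hC)

-- The factor `B = (reg c C)⁻¹ * CFC.sqrt C` satisfies `B * Bᵀ = (reg c C)⁻¹ ^ 2 * C`. The matrix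
-- `C` thus enters only through the map, while the Gaussian being pushed forward stays fixed.
open scoped MatrixOrder in
lemma componentLaw_eq_map {d : ℕ} (θ0 : EuclideanSpace ℝ (Fin d)) (c : ℝ) {s : ℝ} (hs : 0 ≤ s)
    {C : Matrix (Fin d) (Fin d) ℝ} (hC : C.PosSemidef) :
    componentLaw θ0 c s C = (multivariateGaussian 0 (s • (1 : Matrix (Fin d) (Fin d) ℝ))).map
      fun e => act ((reg c C)⁻¹ * C) θ0 + act ((reg c C)⁻¹ * CFC.sqrt C) e := by
  have hRt : (CFC.sqrt C)ᵀ = CFC.sqrt C := by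
    rw [← Matrix.conjTranspose_eq_transpose_of_trivial]
    exact (Matrix.nonneg_iff_posSemidef.1 (CFC.sqrt_nonneg C)).isHermitian.eq
  have hCt : Cᵀ = C := by simpa using hC.isHermitian.eq
  have hsymm : ((reg c C)⁻¹)ᵀ = (reg c C)⁻¹ := by
    rw [Matrix.transpose_nonsing_inv]
    simp [reg, hCt]
  rw [map_affine_multivariateGaussian hs, componentLaw, Matrix.transpose_mul, hRt, hsymm,
    mul_assoc, ← mul_assoc (CFC.sqrt C), CFC.sqrt_mul_sqrt_self C hC.nonneg,
    ← (commute_inv_reg c C).eq, sq, mul_assoc]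

open scoped MatrixOrder in
lemma aemeasurable_componentLaw {d : ℕ} (θ0 : EuclideanSpace ℝ (Fin d)) (c : ℝ) {s : ℝ}
    (hs : 0 ≤ s) {ν : Measure (Matrix (Fin d) (Fin d) ℝ)} (hν : ∀ᵐ C ∂ν, C.PosSemidef) :
    AEMeasurable (componentLaw θ0 c s) ν := by
  have hact : Measurable fun p : Matrix (Fin d) (Fin d) ℝ × EuclideanSpace ℝ (Fin d) =>
      act p.1 p.2 := continuous_act_uncurry.measurable
  have hinv : Measurable fun C : Matrix (Fin d) (Fin d) ℝ => (reg c C)⁻¹ :=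
    (measurable_matrix_inv _).comp (measurable_reg _)
  have hmul : Measurable fun p : Matrix (Fin d) (Fin d) ℝ × Matrix (Fin d) (Fin d) ℝ =>
      p.1 * p.2 := Continuous.measurable (by fun_prop)
  have hF : Measurable fun p : Matrix (Fin d) (Fin d) ℝ × EuclideanSpace ℝ (Fin d) =>
      act ((reg c p.1)⁻¹ * p.1) θ0 + act ((reg c p.1)⁻¹ * CFC.sqrt p.1) p.2 :=
    ((hact.comp ((hmul.comp (hinv.prodMk measurable_id)).prodMk measurable_const)).comp
      measurable_fst).add (hact.comp (((hmul.comp (hinv.prodMk (measurable_cfc_sqrt d))).comp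
        measurable_fst).prodMk measurable_snd))
  refine ⟨_, measurable_measure_map hF
    (multivariateGaussian 0 (s • (1 : Matrix (Fin d) (Fin d) ℝ))), ?_⟩
  filter_upwards [hν] with C hC using componentLaw_eq_map θ0 c hs hC

/-- Scaling of the component law. -/
lemma componentLaw_smul {d : ℕ} (θ0 : EuclideanSpace ℝ (Fin d)) (c s : ℝ) {r : ℝ} (hr : r ≠ 0)
    (A : Matrix (Fin d) (Fin d) ℝ) :
    componentLaw θ0 (r * c) (r * s) A = componentLaw θ0 c s (r⁻¹ • A) := by
  have h1 : reg c (r⁻¹ • A) = r⁻¹ • reg (r * c) A := by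
    rw [reg, reg, smul_add, smul_smul, inv_mul_cancel_left₀ hr]
  have h2 : (reg c (r⁻¹ • A))⁻¹ = r • (reg (r * c) A)⁻¹ := by
    by_cases h : IsUnit (reg (r * c) A).det
    · rw [h1]
      refine Matrix.inv_eq_right_inv ?_
      rw [Matrix.smul_mul, Matrix.mul_smul, Matrix.mul_nonsing_inv _ h, smul_smul,
        inv_mul_cancel₀ hr, one_smul]
    -- Singularity is invariant under scaling by `r⁻¹`, so both inverses are zero here.
    · have h' : ¬IsUnit (reg c (r⁻¹ • A)).det := by
        rw [h1, Matrix.det_smul, IsUnit.mul_iff]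
        exact fun hh => h hh.2
      rw [Matrix.nonsing_inv_apply_not_isUnit _ h, Matrix.nonsing_inv_apply_not_isUnit _ h',
        smul_zero]
  rw [componentLaw, componentLaw, h2]
  have e1 : r • (reg (r * c) A)⁻¹ * r⁻¹ • A = (reg (r * c) A)⁻¹ * A := by
    rw [Matrix.smul_mul, Matrix.mul_smul, smul_smul, mul_inv_cancel₀ hr, one_smul]
  have e2 : s • ((r • (reg (r * c) A)⁻¹) ^ 2 * r⁻¹ • A) =
      (r * s) • ((reg (r * c) A)⁻¹ ^ 2 * A) := by
    rw [smul_pow, Matrix.smul_mul, Matrix.mul_smul, smul_smul, smul_smul]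
    congr 1
    field_simp
  rw [e1, e2]

section

variable {Ω : Type*} [MeasurableSpace Ω] {P : Measure Ω} [IsProbabilityMeasure P]

/-- For a random design independent of Gaussian noise, the estimator is a Gaussian mixture. -/
theorem isMixture_mapEstimator {N d : ℕ} (σ2 η : ℝ) {s : ℝ} (hs : 0 ≤ s)
    (θ0 : EuclideanSpace ℝ (Fin d)) {X : Ω → Matrix (Fin N) (Fin d) ℝ}
    {ε : Ω → EuclideanSpace ℝ (Fin N)} (hX : AEMeasurable X P)
    (hε : HasLaw ε (multivariateGaussian 0 (s • (1 : Matrix (Fin N) (Fin N) ℝ))) P)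
    (hind : IndepFun X ε P) :
    IsMixture (P.map fun ω => mapEstimator σ2 η (X ω) (act (X ω) θ0 + ε ω)) (P.map X)
      (fun A => componentLaw θ0 (σ2 * η) s (gram A)) := by
  have hF := measurable_mapEstimator (N := N) σ2 η θ0
  set γ := multivariateGaussian 0 (s • (1 : Matrix (Fin N) (Fin N) ℝ))
  have hκ : ∀ A : Matrix (Fin N) (Fin d) ℝ, componentLaw θ0 (σ2 * η) s (gram A) =
      γ.map fun e => mapEstimator σ2 η A (act A θ0 + e) := fun A =>
    (map_mapEstimator_eq_componentLaw σ2 η hs θ0 A).symm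
  refine ⟨?_, fun B hB => ?_⟩
  · simp_rw [hκ]
    exact (measurable_measure_map hF γ).aemeasurable
  · have hlaw := IndepFun.hasLaw_prod ⟨hX, rfl⟩ hε hind
    have := Measure.isProbabilityMeasure_map hX
    have hmap : P.map (fun ω => mapEstimator σ2 η (X ω) (act (X ω) θ0 + ε ω)) =
        ((P.map X).prod γ).map fun p => mapEstimator σ2 η p.1 (act p.1 θ0 + p.2) := by
      rw [← hlaw.map_eq, AEMeasurable.map_map_of_aemeasurable hF.aemeasurable hlaw.aemeasurable]
      rfl
    rw [hmap, Measure.map_apply hF hB, Measure.prod_apply (hF hB)]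
    refine lintegral_congr fun A => ?_
    simp only [hκ]
    exact (Measure.map_apply (hF.comp measurable_prodMk_left) hB).symm

end

/-! ### The rescaled Gaussian design -/

lemma gram_inv_sqrt_smul {N d : ℕ} (hd0 : 0 < d) (hN : 0 < N) (Z : Matrix (Fin N) (Fin d) ℝ) :
    gram ((√(d : ℝ))⁻¹ • Z) = ((d : ℝ) / N)⁻¹ • sampleCov Z := by
  have h1 : (0 : ℝ) < d := by exact_mod_cast hd0
  have h2 : (0 : ℝ) < N := by exact_mod_cast hN
  rw [gram, sampleCov, Matrix.transpose_smul, Matrix.smul_mul, Matrix.mul_smul, smul_smul,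
    smul_smul, ← mul_inv, Real.mul_self_sqrt h1.le]
  congr 1
  field_simp

lemma isUnit_det_reg {d : ℕ} {c : ℝ} (hc : 0 ≤ c) {A : Matrix (Fin d) (Fin d) ℝ}
    (hA : A.PosDef) : IsUnit (reg c A).det :=
  (hA.add_posSemidef (Matrix.PosSemidef.one.smul hc)).det_pos.ne'.isUnit

lemma posDef_gram_inv_sqrt_smul {N d : ℕ} (hd : d ≤ N) {Z : Matrix (Fin N) (Fin d) ℝ}
    (hZ : (sampleCov Z).PosDef) : (gram ((√(d : ℝ))⁻¹ • Z)).PosDef := by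
  rcases Nat.eq_zero_or_pos d with rfl | hd0
  · exact posDef_of_fin_zero _
  · have h1 : (0 : ℝ) < d := by exact_mod_cast hd0
    have h2 : (0 : ℝ) < N := by exact_mod_cast hd0.trans_le hd
    rw [gram_inv_sqrt_smul hd0 (hd0.trans_le hd)]
    exact hZ.smul (by positivity)

lemma componentLaw_gram_inv_sqrt_smul {N d : ℕ} (hd : d ≤ N) (θ0 : EuclideanSpace ℝ (Fin d))
    (c s : ℝ) (Z : Matrix (Fin N) (Fin d) ℝ) :
    componentLaw θ0 c s (gram ((√(d : ℝ))⁻¹ • Z)) =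
      componentLaw θ0 ((d : ℝ) / N * c) ((d : ℝ) / N * s) (sampleCov Z) := by
  rcases Nat.eq_zero_or_pos d with rfl | hd0
  -- Here `d / N = 0` cannot be scaled away, but in dimension zero all means and all covariances
  -- coincide.
  · exact congrArg₂ multivariateGaussian (Subsingleton.elim _ _) (Subsingleton.elim _ _)
  · have h1 : (0 : ℝ) < d := by exact_mod_cast hd0
    have h2 : (0 : ℝ) < N := by exact_mod_cast hd0.trans_le hd
    rw [gram_inv_sqrt_smul hd0 (hd0.trans_le hd),
      componentLaw_smul θ0 c s (div_pos h1 h2).ne']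

/-- A mixture may be reindexed along maps that factor its components. -/
lemma IsMixture.of_comp {Ω α α' β : Type*} [MeasurableSpace Ω] [MeasurableSpace α]
    [MeasurableSpace α'] [MeasurableSpace β] {P : Measure Ω} {ρ : Measure β} {X : Ω → α}
    {Y : Ω → α'} {ν : Measure α'} {κ : α → Measure β} {κ' : α' → Measure β}
    (h : IsMixture ρ (P.map X) κ) (hX : AEMeasurable X P) (hY : HasLaw Y ν P)
    (hκ' : AEMeasurable κ' ν) (heq : ∀ ω, κ (X ω) = κ' (Y ω)) : IsMixture ρ ν κ' := by
  refine ⟨hκ', fun B hB => ?_⟩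
  rw [h.2 B hB, lintegral_map' (f := fun a => κ a B)
      ((Measure.measurable_coe hB).comp_aemeasurable h.1) hX,
    ← hY.lintegral_comp (f := fun a => κ' a B) ((Measure.measurable_coe hB).comp_aemeasurable hκ')]
  simp_rw [heq]

end RidgeRegression

end

open RidgeRegression in
theorem mainTheorem3 {N d : ℕ} (σ2 σ02 η : ℝ) (hσ2 : 0 < σ2) (hσ02 : 0 < σ02) (hη : 0 ≤ η)
    (θ0 : EuclideanSpace ℝ (Fin d))
    {Ω : Type*} [MeasurableSpace Ω] (P : Measure Ω) [IsProbabilityMeasure P]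
    (Z : Ω → Matrix (Fin N) (Fin d) ℝ) (ε : Ω → EuclideanSpace ℝ (Fin N))
    (hZ : AEMeasurable Z P)
    (hε : HasLaw ε (multivariateGaussian 0 (σ02 • (1 : Matrix (Fin N) (Fin N) ℝ))) P)
    (hind : IndepFun Z ε P) :
    -- the estimator is the unique minimiser of the energy
    (∀ (X : Matrix (Fin N) (Fin d) ℝ) (t : EuclideanSpace ℝ (Fin N)),
      IsUnit (reg (σ2 * η) (gram X)).det →
      ∀ θ : EuclideanSpace ℝ (Fin d),
        IsMinOn (energy σ2 η X t) Set.univ θ ↔ θ = mapEstimator σ2 η X t) ∧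
    -- arbitrary random design
    ((∀ᵐ ω ∂P, IsUnit (reg (σ2 * η) (gram (Z ω))).det) →
      IsMixture (P.map fun ω => mapEstimator σ2 η (Z ω) (act (Z ω) θ0 + ε ω)) (P.map Z)
        (fun X => componentLaw θ0 (σ2 * η) σ02 (gram X))) ∧
    -- Gaussian rows, with the design rescaled by `1 / √d` and `ζ = d / N`
    (∀ S : Matrix (Fin d) (Fin d) ℝ, S.PosDef → d ≤ N →
      iIndepFun (fun i ω => WithLp.toLp 2 (Z ω i)) P →
      (∀ i, HasLaw (fun ω => WithLp.toLp 2 (Z ω i)) (multivariateGaussian 0 S) P) →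
      HasLaw (fun ω => sampleCov (Z ω)) (wishart ((N : ℝ)⁻¹ • S) N) P ∧
      (∀ᵐ ω ∂P, IsUnit (reg (σ2 * η) (gram ((√(d : ℝ))⁻¹ • Z ω))).det) ∧
      IsMixture
        (P.map fun ω =>
          mapEstimator σ2 η ((√(d : ℝ))⁻¹ • Z ω) (act ((√(d : ℝ))⁻¹ • Z ω) θ0 + ε ω))
        (wishart ((N : ℝ)⁻¹ • S) N)
        (fun C => componentLaw θ0 ((d : ℝ) / N * σ2 * η) ((d : ℝ) / N * σ02) C)) := by
  refine ⟨fun X t h θ => isMinOn_energy_iff hσ2 hη X t h θ,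
    fun _ => isMixture_mapEstimator σ2 η hσ02.le θ0 hZ hε hind, fun S hS hd hrows hlaw => ?_⟩
  have hC := hasLaw_sampleCov_wishart hZ hS hd hrows hlaw
  have hPD : ∀ᵐ C ∂wishart ((N : ℝ)⁻¹ • S) N, C.PosDef := ae_wishart_posDef _ _
  have hsmul : Measurable fun A : Matrix (Fin N) (Fin d) ℝ => (√(d : ℝ))⁻¹ • A :=
    Continuous.measurable (by fun_prop)
  have hX : AEMeasurable (fun ω => (√(d : ℝ))⁻¹ • Z ω) P := hsmul.comp_aemeasurable hZ
  refine ⟨hC, ?_, ?_⟩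
  -- Positive definiteness holds almost surely under the Wishart law and is pulled back along the
  -- sample covariance.
  · filter_upwards [ae_of_ae_map hC.aemeasurable (hC.map_eq.symm ▸ hPD)] with ω hω
    exact isUnit_det_reg (by positivity) (posDef_gram_inv_sqrt_smul hd hω)
  · refine (isMixture_mapEstimator σ2 η hσ02.le θ0 hX hε
      (hind.comp hsmul measurable_id)).of_comp hX hC ?_ fun ω => ?_
    · exact aemeasurable_componentLaw θ0 _ (by positivity) (hPD.mono fun C h => h.posSemidef)
    · rw [mul_assoc ((d : ℝ) / N)]
      exact componentLaw_gram_inv_sqrt_smul hd θ0 (σ2 * η) σ02 (Z ω)
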